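/- For $N\in\mathbb{N}$, $N\ge 1$, let $\Gamma_N$ be the star graph consisting of $N$ half-lines $[0,\infty)$ with their endpoints $0$ identified, so that $\Gamma_2=\mathbb{R}$. Let $V:\Gamma_N\to\mathbb{R}$ satisfy $V_+\in L^1_{\rm loc}(\Gamma_N)$ and $V_-\in L^p(\Gamma_N)$ for some $1\le p<\infty$. Let $H=-\frac{d^2}{dx^2}+V$ be the self-adjoint operator in $L^2(\Gamma_N)$ associated with the quadratic form $$h[\psi]=\int_{\Gamma_N}\left(|\psi'|^2+V|\psi|^2\right)dx,\qquad \psi\in H^1(\Gamma_N)\cap L^2(\Gamma_N,V_+\,dx),$$ where $\psi\in H^1(\Gamma_N)$ means that the restrictions of $\psi$ to the $N$ edges belong to $H^1(0,\infty)$ and that their values at the vertex coincide. Write $\operatorname{tr}H_-^\gamma$ for the sum of $|\lambda|^\gamma$ over the negative eigenvalues $\lambda$ of $H$, counted with multiplicity. Let $L_{\gamma,N}\in[0,\infty]$ be the smallest constant such that $$\operatorname{tr}H_-^\gamma\le L_{\gamma,N}\int_{\Gamma_N}V_-^{\gamma+1/2}\,dx$$ for all such $V$ for which the integral on the right is finite,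 and put $L_\gamma:=L_{\gamma,2}$, the optimal constant for $\Gamma_2=\mathbb{R}$. Let $\gamma\ge 1/2$. If $N_0<N$ are both odd, then $$L_{\gamma,N}\le\frac{N-N_0}{N}\,L_\gamma+\frac{N_0}{N}\,L_{\gamma,N_0}.$$ In particular, if $L_{\gamma,N_0}=L_\gamma$ for some odd $N_0\in\mathbb{N}$, then $L_{\gamma,N}=L_\gamma$ for all $N\ge N_0$ (odd or even). -/

import Mathlib

open MeasureTheory
open scoped ENNReal ComplexConjugate

noncomputable section

namespace StarGraph

/-- Lebesgue measure on the open half-line `(0, ∞)`. -/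
abbrev halfLineMeasure : Measure ℝ := volume.restrict (Set.Ioi (0 : ℝ))

/-- The complex Hilbert space `L²(0, ∞)`. -/
abbrev HalfLineL2 : Type := Lp ℂ 2 halfLineMeasure

/-- `L²(Γ)` for the star graph `Γ` whose edges, copies of the half-line `[0, ∞)` glued at `0`, are
indexed by the finite type `ι`. The graph `Γ_N` is the case `ι = Fin N`. A function on `Γ` is given
by its restrictions to the edges, and `‖ψ‖² = ∑ i, ‖ψ i‖²`. -/
abbrev StarL2 (ι : Type) [Fintype ι] : Type := PiLp 2 (fun _ : ι => HalfLineL2)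

/-- `u ∈ H¹(0, ∞)`, with (weak) derivative `u' ∈ L²(0, ∞)` and boundary value `c = u(0)`: the
class `u` has the absolutely continuous representative `x ↦ c + ∫₀ˣ u'`. -/
def HasDerivTrace (u u' : HalfLineL2) (c : ℂ) : Prop :=
  ∀ᵐ x ∂halfLineMeasure, u x = c + ∫ t in (0 : ℝ)..x, u' t

variable {ι : Type} [Fintype ι]

/-- `ψ ∈ H¹(Γ)` with derivative `ψ'`: all restrictions of `ψ` to the edges belong to `H¹(0, ∞)`,
and their values at the vertex coincide. -/
def HasStarDeriv (ψ ψ' : StarL2 ι) : Prop :=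
  ∃ c : ℂ, ∀ i, HasDerivTrace (ψ i) (ψ' i) c

/-- The standing assumptions on a potential `V : Γ → ℝ`, given by its restrictions `V i` to the
edges (only the values on `(0, ∞)` matter): the positive part is locally integrable (up to the
vertex), and the negative part is in `L^p` for some `1 ≤ p < ∞`. -/
structure IsPotential (V : ι → ℝ → ℝ) : Prop where
  posPart_loc : ∀ i, ∀ R : ℝ, IntegrableOn (fun x => (V i x)⁺) (Set.Ioc 0 R) volume
  negPart_memLp : ∃ p : ℝ≥0∞, 1 ≤ p ∧ p ≠ ∞ ∧
    ∀ i, MemLp (fun x => (V i x)⁻) p halfLineMeasure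

/-- The form domain `H¹(Γ) ∩ L²(Γ, V₊ dx)`. An element carries its derivative, which is determined
by the function. -/
structure FormDomain (V : ι → ℝ → ℝ) where
  toL2 : StarL2 ι
  deriv : StarL2 ι
  hasStarDeriv : HasStarDeriv toL2 deriv
  lintegral_posPart_lt_top :
    ∀ i, ∫⁻ x in Set.Ioi (0 : ℝ), ENNReal.ofReal ((V i x)⁺ * ‖toL2 i x‖ ^ 2) < ∞

/-- The sesquilinear form (antilinear in `φ`, linear in `ψ`)
`h[φ, ψ] = ∫_Γ (conj φ' ψ' + V conj φ ψ) dx`, whose quadratic form is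
`h[ψ] = ∫_Γ (|ψ'|² + V |ψ|²) dx`. -/
def form (V : ι → ℝ → ℝ) (φ ψ : FormDomain V) : ℂ :=
  inner ℂ φ.deriv ψ.deriv +
    ∑ i, ∫ x in Set.Ioi (0 : ℝ), (V i x : ℂ) * conj (φ.toL2 i x) * ψ.toL2 i x

/-- The graph of the self-adjoint Schrödinger operator `H = -d²/dx² + V` in `L²(Γ)` associated with
the form: `u ∈ dom H` and `H u = f` means that `u` belongs to the form domain and `h[φ, u] = ⟪φ, f⟫`
for all `φ` in the form domain. -/
def IsSchrodinger (V : ι → ℝ → ℝ) (u f : StarL2 ι) : Prop :=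
  ∃ ψ : FormDomain V, ψ.toL2 = u ∧ ∀ φ : FormDomain V, form V φ ψ = inner ℂ φ.toL2 f

/-- The eigenspace `ker (H - lam)`, written as the span of the solutions of `H u = lam u`. -/
def eigenspace (V : ι → ℝ → ℝ) (lam : ℝ) : Submodule ℂ (StarL2 ι) :=
  Submodule.span ℂ {u | IsSchrodinger V u ((lam : ℂ) • u)}

/-- The multiplicity `dim ker (H - lam)`; it is `0` unless `lam` is an eigenvalue. -/
def multiplicity (V : ι → ℝ → ℝ) (lam : ℝ) : ℕ∞ :=
  Cardinal.toENat (Module.rank ℂ (eigenspace V lam))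

/-- `tr H₋^γ`: the sum of `|lam| ^ γ` over the negative eigenvalues `lam` of `H`, counted with
multiplicity. -/
def traceNeg (γ : ℝ) (V : ι → ℝ → ℝ) : ℝ≥0∞ :=
  ∑' lam : Set.Iio (0 : ℝ),
    (multiplicity V (lam : ℝ) : ℝ≥0∞) * ENNReal.ofReal (|(lam : ℝ)| ^ γ)

/-- `∫_Γ V₋^(γ + 1/2) dx`. -/
def negIntegral (γ : ℝ) (V : ι → ℝ → ℝ) : ℝ≥0∞ :=
  ∑ i, ∫⁻ x in Set.Ioi (0 : ℝ), ENNReal.ofReal ((V i x)⁻ ^ (γ + 1 / 2))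

/-- The optimal constant `L_{γ,N}` in `tr H₋^γ ≤ L_{γ,N} ∫_{Γ_N} V₋^(γ + 1/2) dx`, the smallest
one in `[0, ∞]`. The inequality is void when its right-hand integral is infinite. -/
def optConst (γ : ℝ) (N : ℕ) : ℝ≥0∞ :=
  sInf {L : ℝ≥0∞ | ∀ V : Fin N → ℝ → ℝ, IsPotential V → negIntegral γ V ≠ ∞ →
    traceNeg γ V ≤ L * negIntegral γ V}

/-- `L_γ := L_{γ,2}`, the optimal constant for the line `ℝ = Γ_2`. -/
def lineConst (γ : ℝ) : ℝ≥0∞ := optConst γ 2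

end StarGraph

end

/-!
By the layer-cake formula, `tr H₋^γ` is an integral over `E < 0` of the number of eigenvalues below
`E`, which by Glazman's principle is the largest dimension of a subspace of the form domain on which
`h - E` is negative definite. Dropping the continuity condition between two groups of `M` and `K`
edges enlarges the form domain, so `tr H₋^γ` on `Γ_{M+K}` is at most the sum of the traces on `Γ_M`
and `Γ_K`, hence at most `L_{γ,M} ∫ V₋^{γ+1/2} + L_{γ,K} ∫ V₋^{γ+1/2}` over the respective edges.
Averaging over the cyclic choices of the groups gives
`L_{γ,M+K} ≤ (M / (M + K)) L_{γ,M} + (K / (M + K)) L_{γ,K}`. In particular `L_{γ,2m} ≤ L_γ`, because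
pairs of edges are lines, and the inequality for odd `N₀ < N` follows from `N = 2m + N₀`.

Conversely `L_γ ≤ L_{γ,N}`: transplant a potential on the line to one edge, with the origin at a
large distance `R` from the vertex, and copy the part of the line that has been cut off to the other
edges. As `R → ∞` these copies vanish, negative definite subspaces for the line persist on `Γ_N`,
and Fatou's lemma yields the inequality of the traces.
-/

noncomputable section

namespace StarGraph

open Filter Topology Set

section HalfLine

/-! ### Functions of class `H¹` on the half-line -/

theorem aestronglyMeasurable_coe (u : HalfLineL2) : AEStronglyMeasurable u halfLineMeasure :=
  (Lp.memLp u).aestronglyMeasurable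

theorem integrable_norm_sq (u : HalfLineL2) : Integrable (fun x => ‖u x‖ ^ 2) halfLineMeasure :=
  (memLp_two_iff_integrable_sq_norm (aestronglyMeasurable_coe u)).1 (Lp.memLp u)

theorem norm_sq_eq_integral (u : HalfLineL2) : ‖u‖ ^ 2 = ∫ x, ‖u x‖ ^ 2 ∂halfLineMeasure := by
  have h := inner_self_eq_norm_sq_to_K (𝕜 := ℂ) u
  rw [L2.inner_def] at h
  simp only [inner_self_eq_norm_sq_to_K, Complex.coe_algebraMap, ← Complex.ofReal_pow,
    integral_complex_ofReal] at h
  exact (Complex.ofReal_injective h).symm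

theorem integrableOn_Ioc_coe (v : HalfLineL2) {a : ℝ} (ha : 0 ≤ a) (b : ℝ) :
    IntegrableOn v (Ioc a b) volume := by
  have hsub : Ioc a b ⊆ Ioi 0 := fun x hx => lt_of_le_of_lt ha hx.1
  have hv : MemLp v 2 (volume.restrict (Ioc a b)) :=
    (Lp.memLp v).mono_measure (Measure.restrict_mono hsub le_rfl)
  exact hv.integrable one_le_two

theorem intervalIntegrable_coe (v : HalfLineL2) {a b : ℝ} (ha : 0 ≤ a) (hb : 0 ≤ b) :
    IntervalIntegrable v volume a b :=
  ⟨integrableOn_Ioc_coe v ha b, integrableOn_Ioc_coe v hb a⟩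

theorem norm_intervalIntegral_le (v : HalfLineL2) {a b : ℝ} (ha : 0 ≤ a) (hab : a ≤ b) :
    ‖∫ t in a..b, v t‖ ≤ √(b - a) * ‖v‖ := by
  have hsub : Ioc a b ⊆ Ioi 0 := fun x hx => lt_of_le_of_lt ha hx.1
  have hμ : halfLineMeasure (Ioc a b) = ENNReal.ofReal (b - a) := by
    rw [Measure.restrict_apply measurableSet_Ioc, inter_eq_left.2 hsub, Real.volume_Ioc]
  have hfin : halfLineMeasure (Ioc a b) ≠ ∞ := hμ ▸ ENNReal.ofReal_ne_top
  have hinner : ∫ t in a..b, v t =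
      inner ℂ (indicatorConstLp 2 measurableSet_Ioc hfin (1 : ℂ)) v := by
    rw [L2.inner_indicatorConstLp_one (𝕜 := ℂ) measurableSet_Ioc hfin v,
      intervalIntegral.integral_of_le hab, Measure.restrict_restrict measurableSet_Ioc,
      inter_eq_left.2 hsub]
  have hnorm : ‖indicatorConstLp 2 measurableSet_Ioc hfin (1 : ℂ)‖ = √(b - a) := by
    rw [norm_indicatorConstLp two_ne_zero ENNReal.ofNat_ne_top, Measure.real, hμ,
      ENNReal.toReal_ofReal (sub_nonneg.2 hab), Real.sqrt_eq_rpow]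
    norm_num
  rw [hinner, ← hnorm]
  exact norm_inner_le_norm _ _

theorem intervalIntegral_coe_add (v w : HalfLineL2) {a b : ℝ} (ha : 0 ≤ a) (hab : a ≤ b) :
    ∫ t in a..b, (v + w : HalfLineL2) t = (∫ t in a..b, v t) + ∫ t in a..b, w t := by
  rw [← intervalIntegral.integral_add (intervalIntegrable_coe v ha (ha.trans hab))
    (intervalIntegrable_coe w ha (ha.trans hab))]
  refine intervalIntegral.integral_congr_ae ?_
  filter_upwards [(ae_restrict_iff' measurableSet_Ioi).1 (Lp.coeFn_add v w)] with t ht hmem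
  rw [uIoc_of_le hab] at hmem
  exact ht (lt_of_le_of_lt ha hmem.1)

theorem intervalIntegral_coe_smul (k : ℂ) (v : HalfLineL2) {a b : ℝ} (ha : 0 ≤ a) (hab : a ≤ b) :
    ∫ t in a..b, (k • v : HalfLineL2) t = k * ∫ t in a..b, v t := by
  rw [← intervalIntegral.integral_const_mul]
  refine intervalIntegral.integral_congr_ae ?_
  filter_upwards [(ae_restrict_iff' measurableSet_Ioi).1 (Lp.coeFn_smul k v)] with t ht hmem
  rw [uIoc_of_le hab] at hmem
  exact ht (lt_of_le_of_lt ha hmem.1)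

/-- The absolutely continuous function on `[0, ∞)` with value `c` at `0` and derivative `v`; it is
the continuous representative of a function of class `H¹`. -/
def primitive (c : ℂ) (v : HalfLineL2) (x : ℝ) : ℂ := c + ∫ t in (0 : ℝ)..x, v t

theorem primitive_zero_right (c : ℂ) (v : HalfLineL2) : primitive c v 0 = c := by
  rw [primitive, intervalIntegral.integral_same, add_zero]

theorem primitive_sub_primitive (c : ℂ) (v : HalfLineL2) {x y : ℝ} (hx : 0 ≤ x) (hy : 0 ≤ y) :
    primitive c v y - primitive c v x = ∫ t in x..y, v t := by
  rw [← intervalIntegral.integral_interval_sub_left (intervalIntegrable_coe v le_rfl hy)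
    (intervalIntegrable_coe v le_rfl hx), primitive, primitive, add_sub_add_left_eq_sub]

theorem norm_primitive_sub_primitive_le (c : ℂ) (v : HalfLineL2) {x y : ℝ} (hx : 0 ≤ x)
    (hxy : x ≤ y) : ‖primitive c v y - primitive c v x‖ ≤ √(y - x) * ‖v‖ := by
  rw [primitive_sub_primitive c v hx (hx.trans hxy)]
  exact norm_intervalIntegral_le v hx hxy

theorem primitive_add (c d : ℂ) (v w : HalfLineL2) {x : ℝ} (hx : 0 ≤ x) :
    primitive (c + d) (v + w) x = primitive c v x + primitive d w x := by
  rw [primitive, intervalIntegral_coe_add v w le_rfl hx, primitive, primitive,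
    add_add_add_comm]

theorem primitive_smul (k c : ℂ) (v : HalfLineL2) {x : ℝ} (hx : 0 ≤ x) :
    primitive (k * c) (k • v) x = k * primitive c v x := by
  rw [primitive, intervalIntegral_coe_smul k v le_rfl hx, primitive, mul_add]

theorem primitive_sub (c d : ℂ) (v w : HalfLineL2) {x : ℝ} (hx : 0 ≤ x) :
    primitive (c - d) (v - w) x = primitive c v x - primitive d w x := by
  have h := primitive_add (c - d) d (v - w) w hx
  rw [sub_add_cancel, sub_add_cancel] at h
  exact eq_sub_of_add_eq h.symm

theorem tendsto_primitive {c : ℕ → ℂ} {v : ℕ → HalfLineL2} {c₀ : ℂ} {v₀ : HalfLineL2}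
    (hc : Tendsto c atTop (𝓝 c₀)) (hv : Tendsto v atTop (𝓝 v₀)) {x : ℝ} (hx : 0 ≤ x) :
    Tendsto (fun n => primitive (c n) (v n) x) atTop (𝓝 (primitive c₀ v₀ x)) := by
  rw [tendsto_iff_norm_sub_tendsto_zero] at hc hv ⊢
  have hbound : Tendsto (fun n => ‖c n - c₀‖ + √(x - 0) * ‖v n - v₀‖) atTop (𝓝 0) := by
    simpa only [mul_zero, add_zero] using hc.add (hv.const_mul √(x - 0))
  refine squeeze_zero (fun _ => norm_nonneg _) (fun n => ?_) hbound
  rw [← primitive_sub _ _ _ _ hx, primitive]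
  exact norm_add_le_of_le le_rfl (norm_intervalIntegral_le _ le_rfl hx)

theorem norm_add_sq_le_two_mul (a b : ℂ) : ‖a + b‖ ^ 2 ≤ 2 * ‖a‖ ^ 2 + 2 * ‖b‖ ^ 2 := by
  nlinarith [norm_add_le a b, norm_nonneg (a + b), sq_nonneg (‖a‖ - ‖b‖)]

theorem norm_primitive_sq_le_of_le (c : ℂ) (v : HalfLineL2) {x y δ : ℝ} (hx : 0 ≤ x)
    (hxy : x ≤ y) (hδ : y ≤ x + δ) :
    ‖primitive c v x‖ ^ 2 ≤ 2 * ‖primitive c v y‖ ^ 2 + 2 * δ * ‖v‖ ^ 2 := by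
  have hdiff : ‖primitive c v y - primitive c v x‖ ^ 2 ≤ δ * ‖v‖ ^ 2 := by
    calc ‖primitive c v y - primitive c v x‖ ^ 2
        ≤ (√(y - x) * ‖v‖) ^ 2 := by
          gcongr
          exact norm_primitive_sub_primitive_le c v hx hxy
      _ = (y - x) * ‖v‖ ^ 2 := by rw [mul_pow, Real.sq_sqrt (sub_nonneg.2 hxy)]
      _ ≤ δ * ‖v‖ ^ 2 := by
          gcongr
          linarith
  have h := norm_add_sq_le_two_mul (primitive c v y) (-(primitive c v y - primitive c v x))
  rw [norm_neg, ← sub_eq_add_neg, sub_sub_cancel] at h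
  linarith

namespace HasDerivTrace

theorem add {u u' v v' : HalfLineL2} {c d : ℂ} (h : HasDerivTrace u u' c)
    (h' : HasDerivTrace v v' d) : HasDerivTrace (u + v) (u' + v') (c + d) := by
  filter_upwards [h, h', Lp.coeFn_add u v, ae_restrict_mem measurableSet_Ioi] with x h1 h2 h3 hx
  rw [h3, Pi.add_apply, h1, h2]
  exact (primitive_add c d u' v' (le_of_lt hx)).symm

theorem smul {u u' : HalfLineL2} {c : ℂ} (k : ℂ) (h : HasDerivTrace u u' c) :
    HasDerivTrace (k • u) (k • u') (k * c) := by
  filter_upwards [h, Lp.coeFn_smul k u, ae_restrict_mem measurableSet_Ioi] with x h1 h2 hx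
  rw [h2, Pi.smul_apply, h1]
  exact (primitive_smul k c u' (le_of_lt hx)).symm

theorem zero : HasDerivTrace 0 0 0 := by
  filter_upwards [Lp.coeFn_zero ℂ 2 halfLineMeasure, ae_restrict_mem measurableSet_Ioi]
    with x h1 hx
  have h := primitive_smul 0 0 0 (le_of_lt hx)
  rw [smul_zero, mul_zero, zero_mul] at h
  rw [h1]
  exact h.symm

theorem of_tendsto {u v : ℕ → HalfLineL2} {c : ℕ → ℂ} {u₀ v₀ : HalfLineL2} {c₀ : ℂ}
    (h : ∀ n, HasDerivTrace (u n) (v n) (c n)) (hu : Tendsto u atTop (𝓝 u₀))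
    (hv : Tendsto v atTop (𝓝 v₀)) (hc : Tendsto c atTop (𝓝 c₀)) : HasDerivTrace u₀ v₀ c₀ := by
  obtain ⟨ns, hns, hae⟩ := (tendstoInMeasure_of_tendsto_Lp hu).exists_seq_tendsto_ae
  filter_upwards [hae, ae_all_iff.2 h, ae_restrict_mem measurableSet_Ioi] with x hlim hrep hx
  refine tendsto_nhds_unique hlim ?_
  exact ((tendsto_primitive hc hv (le_of_lt hx)).comp hns.tendsto_atTop).congr
    fun n => (hrep (ns n)).symm

variable {u u' : HalfLineL2} {c : ℂ}

theorem norm_primitive_sq_le (h : HasDerivTrace u u' c) {x δ : ℝ} (hx : 0 ≤ x) (hδ : 0 < δ) :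
    ‖primitive c u' x‖ ^ 2 ≤ 2 / δ * ‖u‖ ^ 2 + 2 * δ * ‖u'‖ ^ 2 := by
  have hsub : Ioc x (x + δ) ⊆ Ioi 0 := fun y hy => lt_of_le_of_lt hx hy.1
  have hInt : IntegrableOn (fun y => ‖u y‖ ^ 2) (Ioc x (x + δ)) volume :=
    IntegrableOn.mono_set (integrable_norm_sq u) hsub
  have hu : ∫ y in Ioc x (x + δ), ‖u y‖ ^ 2 ≤ ‖u‖ ^ 2 := by
    rw [norm_sq_eq_integral]
    exact setIntegral_mono_set (integrable_norm_sq u) (Eventually.of_forall fun _ => by positivity)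
      (Eventually.of_forall hsub)
  have hconst (r : ℝ) : ∫ _ in Ioc x (x + δ), r = δ * r := by
    rw [setIntegral_const, Real.volume_real_Ioc, add_sub_cancel_left, max_eq_left hδ.le,
      smul_eq_mul]
  -- average `norm_primitive_sq_le_of_le` over `y ∈ (x, x + δ]`
  have haverage : δ * ‖primitive c u' x‖ ^ 2 ≤ 2 * ‖u‖ ^ 2 + δ * (2 * δ * ‖u'‖ ^ 2) := by
    calc δ * ‖primitive c u' x‖ ^ 2
        = ∫ _ in Ioc x (x + δ), ‖primitive c u' x‖ ^ 2 := (hconst _).symm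
      _ ≤ ∫ y in Ioc x (x + δ), (2 * ‖u y‖ ^ 2 + 2 * δ * ‖u'‖ ^ 2) := by
          refine setIntegral_mono_on_ae (integrableOn_const (by simp))
            ((hInt.const_mul 2).add (integrableOn_const (by simp))) measurableSet_Ioc ?_
          filter_upwards [(ae_restrict_iff' measurableSet_Ioi).1 h] with y hy hmem
          rw [hy (hsub hmem)]
          exact norm_primitive_sq_le_of_le c u' hx hmem.1.le hmem.2
      _ = 2 * (∫ y in Ioc x (x + δ), ‖u y‖ ^ 2) + δ * (2 * δ * ‖u'‖ ^ 2) := by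
          rw [integral_add (hInt.const_mul 2) (integrableOn_const (by simp)), integral_const_mul,
            hconst]
      _ ≤ 2 * ‖u‖ ^ 2 + δ * (2 * δ * ‖u'‖ ^ 2) := by gcongr
  have hscale : 2 / δ * ‖u‖ ^ 2 + 2 * δ * ‖u'‖ ^ 2 =
      (2 * ‖u‖ ^ 2 + δ * (2 * δ * ‖u'‖ ^ 2)) / δ := by field_simp
  rwa [hscale, le_div_iff₀' hδ]

theorem ae_norm_sq_le (h : HasDerivTrace u u' c) {δ : ℝ} (hδ : 0 < δ) :
    ∀ᵐ x ∂halfLineMeasure, ‖u x‖ ^ 2 ≤ 2 / δ * ‖u‖ ^ 2 + 2 * δ * ‖u'‖ ^ 2 := by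
  filter_upwards [h, ae_restrict_mem measurableSet_Ioi] with x hrep hx
  rw [hrep]
  exact h.norm_primitive_sq_le (le_of_lt hx) hδ

theorem integrable_mul_norm_sq (h : HasDerivTrace u u' c) {w : ℝ → ℝ}
    (hw : Integrable w halfLineMeasure) :
    Integrable (fun x => w x * ‖u x‖ ^ 2) halfLineMeasure := by
  refine hw.mul_bdd (c := 2 / 1 * ‖u‖ ^ 2 + 2 * 1 * ‖u'‖ ^ 2)
    ((aestronglyMeasurable_coe u).norm.pow 2) ?_
  filter_upwards [h.ae_norm_sq_le one_pos] with x hx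
  rwa [norm_pow, norm_norm]

theorem integral_mul_norm_sq_le (h : HasDerivTrace u u' c) {w : ℝ → ℝ}
    (hw : Integrable w halfLineMeasure) (hw0 : ∀ x, 0 ≤ w x) {δ : ℝ} (hδ : 0 < δ) :
    ∫ x in Ioi (0 : ℝ), w x * ‖u x‖ ^ 2 ≤
      (∫ x in Ioi (0 : ℝ), w x) * (2 / δ * ‖u‖ ^ 2 + 2 * δ * ‖u'‖ ^ 2) := by
  rw [← integral_mul_const]
  refine integral_mono_ae (h.integrable_mul_norm_sq hw) (hw.mul_const _) ?_
  filter_upwards [h.ae_norm_sq_le hδ] with x hx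
  exact mul_le_mul_of_nonneg_left hx (hw0 x)

end HasDerivTrace

end HalfLine

section SesquilinearForms

/-! ### Symmetric sesquilinear forms and the vectors they represent -/

variable {D H : Type*} [AddCommGroup D] [Module ℂ D] [NormedAddCommGroup H]
  [InnerProductSpace ℂ H]

/-- The quadratic form of a symmetric sesquilinear form; the diagonal values are then real, so
taking the real part loses nothing. -/
def energy (B : D →ₗ⋆[ℂ] D →ₗ[ℂ] ℂ) (p : D) : ℝ := (B p p).re

theorem energy_smul (B : D →ₗ⋆[ℂ] D →ₗ[ℂ] ℂ) (k : ℂ) (p : D) :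
    energy B (k • p) = ‖k‖ ^ 2 * energy B p := by
  simp only [energy, map_smulₛₗ, LinearMap.smul_apply, smul_eq_mul, RingHom.id_apply]
  rw [← mul_assoc, Complex.mul_conj', ← Complex.ofReal_pow, Complex.re_ofReal_mul]

theorem energy_add {B : D →ₗ⋆[ℂ] D →ₗ[ℂ] ℂ} (hB : B.IsSymm) (p q : D) :
    energy B (p + q) = energy B p + energy B q + 2 * (B p q).re := by
  have hsymm : (B q p).re = (B p q).re := by rw [← hB.eq p q, Complex.conj_re]
  simp only [energy, map_add, LinearMap.add_apply, Complex.add_re, hsymm]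
  ring

theorem im_apply_eq_re (B : D →ₗ⋆[ℂ] D →ₗ[ℂ] ℂ) (p q : D) :
    (B p q).im = (B (Complex.I • p) q).re := by
  simp only [map_smulₛₗ, LinearMap.smul_apply, smul_eq_mul, Complex.conj_I, neg_mul,
    Complex.neg_re, Complex.I_mul_re, neg_neg]

theorem energy_add_add_energy_sub (B : D →ₗ⋆[ℂ] D →ₗ[ℂ] ℂ) (p q : D) :
    energy B (p + q) + energy B (p - q) = 2 * (energy B p + energy B q) := by
  simp only [energy, map_add, map_sub, LinearMap.add_apply, LinearMap.sub_apply, Complex.add_re,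
    Complex.sub_re]
  ring

theorem energy_sum_smul (B : D →ₗ⋆[ℂ] D →ₗ[ℂ] ℂ) {κ : Type*} [Fintype κ] (f : κ → D)
    (a : κ → ℂ) :
    energy B (∑ i, a i • f i) = (∑ i, ∑ j, conj (a i) * a j * B (f i) (f j)).re := by
  simp only [energy, map_sum, map_smulₛₗ, LinearMap.sum_apply, LinearMap.smul_apply, smul_eq_mul,
    RingHom.id_apply, Finset.mul_sum]
  rw [Finset.sum_comm]
  refine congrArg Complex.re (Finset.sum_congr rfl fun i _ => Finset.sum_congr rfl fun j _ => ?_)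
  ring

theorem re_apply_eq_zero_of_energy_eq_zero {B : D →ₗ⋆[ℂ] D →ₗ[ℂ] ℂ} (hB : B.IsSymm)
    {X : Submodule ℂ D} (hX : ∀ x ∈ X, 0 ≤ energy B x) {x y : D} (hx : x ∈ X) (hy : y ∈ X)
    (hy0 : energy B y = 0) : (B x y).re = 0 := by
  have hdiscrim : discrim (energy B x) (2 * (B x y).re) 0 ≤ 0 := by
    refine discrim_le_zero fun t => ?_
    have ht := hX _ (X.add_mem (X.smul_mem (t : ℂ) hx) hy)
    rw [energy_add hB, energy_smul, hy0, map_smulₛₗ, LinearMap.smul_apply, smul_eq_mul,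
      Complex.conj_ofReal, Complex.re_ofReal_mul, Complex.norm_real, Real.norm_eq_abs,
      sq_abs] at ht
    linarith
  rw [discrim] at hdiscrim
  nlinarith

theorem apply_eq_zero_of_energy_eq_zero {B : D →ₗ⋆[ℂ] D →ₗ[ℂ] ℂ} (hB : B.IsSymm)
    {X : Submodule ℂ D} (hX : ∀ x ∈ X, 0 ≤ energy B x) {x y : D} (hx : x ∈ X) (hy : y ∈ X)
    (hy0 : energy B y = 0) : B x y = 0 := by
  have him := re_apply_eq_zero_of_energy_eq_zero hB hX (X.smul_mem Complex.I hx) hy hy0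
  rw [← im_apply_eq_re] at him
  exact Complex.ext (re_apply_eq_zero_of_energy_eq_zero hB hX hx hy hy0) him

/-- The form of `A - lam`, where `A` is the operator associated with the form `B` and the embedding
`j` of the form domain into the Hilbert space. -/
def shift (B : D →ₗ⋆[ℂ] D →ₗ[ℂ] ℂ) (j : D →ₗ[ℂ] H) (lam : ℝ) : D →ₗ⋆[ℂ] D →ₗ[ℂ] ℂ :=
  B - (lam : ℂ) • ((innerₛₗ ℂ).compl₂ j).comp j

theorem shift_apply (B : D →ₗ⋆[ℂ] D →ₗ[ℂ] ℂ) (j : D →ₗ[ℂ] H) (lam : ℝ) (p q : D) :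
    shift B j lam p q = B p q - lam * inner ℂ (j p) (j q) := rfl

theorem energy_shift (B : D →ₗ⋆[ℂ] D →ₗ[ℂ] ℂ) (j : D →ₗ[ℂ] H) (lam : ℝ) (p : D) :
    energy (shift B j lam) p = energy B p - lam * ‖j p‖ ^ 2 := by
  rw [energy, shift_apply, Complex.sub_re, Complex.re_ofReal_mul, inner_self_eq_norm_sq_to_K]
  norm_cast

theorem shift_isSymm {B : D →ₗ⋆[ℂ] D →ₗ[ℂ] ℂ} (hB : B.IsSymm) (j : D →ₗ[ℂ] H) (lam : ℝ) :
    (shift B j lam).IsSymm :=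
  ⟨fun p q => by
    rw [shift_apply, shift_apply, map_sub, map_mul, hB.eq, inner_conj_symm, Complex.conj_ofReal]⟩

/-- The graph of the operator associated with the form `B` and the embedding `j` of the form domain
into the Hilbert space. -/
def Represents (B : D →ₗ⋆[ℂ] D →ₗ[ℂ] ℂ) (j : D →ₗ[ℂ] H) (u f : H) : Prop :=
  ∃ p, j p = u ∧ ∀ q, B q p = inner ℂ (j q) f

namespace Represents

variable {B : D →ₗ⋆[ℂ] D →ₗ[ℂ] ℂ} {j : D →ₗ[ℂ] H} {u v f g : H}

theorem add (hu : Represents B j u f) (hv : Represents B j v g) :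
    Represents B j (u + v) (f + g) := by
  obtain ⟨p, rfl, hp⟩ := hu
  obtain ⟨q, rfl, hq⟩ := hv
  exact ⟨p + q, map_add _ _ _, fun r => by rw [map_add, hp, hq, inner_add_right]⟩

variable (B j) in
theorem zero : Represents B j 0 0 :=
  ⟨0, map_zero _, fun r => by rw [map_zero, inner_zero_right]⟩

end Represents

/-- The weak solutions in the form domain of `A p = lam p`, where `A` is the operator associated
with `B` and `j`. -/
def weakEigenspace (B : D →ₗ⋆[ℂ] D →ₗ[ℂ] ℂ) (j : D →ₗ[ℂ] H) (lam : ℝ) : Submodule ℂ D :=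
  (shift B j lam).flip.ker

theorem mem_weakEigenspace {B : D →ₗ⋆[ℂ] D →ₗ[ℂ] ℂ} {j : D →ₗ[ℂ] H} {lam : ℝ} {p : D} :
    p ∈ weakEigenspace B j lam ↔ ∀ q, B q p = lam * inner ℂ (j q) (j p) := by
  simp only [weakEigenspace, LinearMap.mem_ker, LinearMap.ext_iff, LinearMap.flip_apply,
    LinearMap.zero_apply, shift_apply, sub_eq_zero]

/-- The eigenspace `ker (A - lam)` of the operator `A` associated with `B` and `j`. -/
def formEigenspace (B : D →ₗ⋆[ℂ] D →ₗ[ℂ] ℂ) (j : D →ₗ[ℂ] H) (lam : ℝ) : Submodule ℂ H :=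
  (weakEigenspace B j lam).map j

theorem mem_formEigenspace {B : D →ₗ⋆[ℂ] D →ₗ[ℂ] ℂ} {j : D →ₗ[ℂ] H} {lam : ℝ} {u : H} :
    u ∈ formEigenspace B j lam ↔ Represents B j u ((lam : ℂ) • u) := by
  simp only [formEigenspace, Submodule.mem_map, mem_weakEigenspace, Represents]
  refine exists_congr fun p => ⟨?_, ?_⟩
  · rintro ⟨hp, rfl⟩
    exact ⟨rfl, fun q => by rw [hp, inner_smul_right]⟩
  · rintro ⟨rfl, hp⟩
    exact ⟨fun q => by rw [hp, inner_smul_right], rfl⟩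

theorem isOrtho_formEigenspace {B : D →ₗ⋆[ℂ] D →ₗ[ℂ] ℂ} (hB : B.IsSymm) (j : D →ₗ[ℂ] H)
    {lam mu : ℝ} (hne : lam ≠ mu) : formEigenspace B j lam ⟂ formEigenspace B j mu := by
  rw [Submodule.isOrtho_iff_inner_eq]
  rintro _ ⟨p, hp, rfl⟩ _ ⟨q, hq, rfl⟩
  have hpq : (mu : ℂ) * inner ℂ (j p) (j q) = lam * inner ℂ (j p) (j q) := by
    calc (mu : ℂ) * inner ℂ (j p) (j q)
        = B p q := (mem_weakEigenspace.1 hq p).symm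
      _ = conj (B q p) := (hB.eq q p).symm
      _ = lam * inner ℂ (j p) (j q) := by
          rw [mem_weakEigenspace.1 hp, map_mul, Complex.conj_ofReal, inner_conj_symm]
  by_contra hinner
  exact hne (Complex.ofReal_injective (mul_right_cancel₀ hinner hpq)).symm

/-- The span of the eigenspaces for eigenvalues below `E`. -/
def spectralSubspace (B : D →ₗ⋆[ℂ] D →ₗ[ℂ] ℂ) (j : D →ₗ[ℂ] H) (E : ℝ) : Submodule ℂ H :=
  ⨆ lam : Iio E, formEigenspace B j lam

theorem formEigenspace_le_spectralSubspace (B : D →ₗ⋆[ℂ] D →ₗ[ℂ] ℂ) (j : D →ₗ[ℂ] H) {lam E : ℝ}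
    (hlam : lam < E) : formEigenspace B j lam ≤ spectralSubspace B j E :=
  le_iSup (fun mu : Iio E => formEigenspace B j mu) ⟨lam, hlam⟩

theorem spectralSubspace_mono (B : D →ₗ⋆[ℂ] D →ₗ[ℂ] ℂ) (j : D →ₗ[ℂ] H) :
    Monotone (spectralSubspace B j) := fun _ _ hE =>
  iSup_le fun lam => formEigenspace_le_spectralSubspace B j (lam.2.trans_le hE)

theorem exists_represents_of_mem_spectralSubspace {B : D →ₗ⋆[ℂ] D →ₗ[ℂ] ℂ} {j : D →ₗ[ℂ] H}
    {E : ℝ} {u : H} (hu : u ∈ spectralSubspace B j E) :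
    ∃ f ∈ spectralSubspace B j E, Represents B j u f := by
  refine Submodule.iSup_induction _
    (motive := fun u => ∃ f ∈ spectralSubspace B j E, Represents B j u f) hu
    (fun lam u hu => ?_) ?_ ?_
  · exact ⟨_, Submodule.smul_mem _ _ (formEigenspace_le_spectralSubspace B j lam.2 hu),
      mem_formEigenspace.1 hu⟩
  · exact ⟨0, zero_mem _, .zero B j⟩
  · rintro u v ⟨f, hf, hu⟩ ⟨g, hg, hv⟩
    exact ⟨f + g, add_mem hf hg, hu.add hv⟩

theorem energy_shift_sum_of_mem_weakEigenspace {B : D →ₗ⋆[ℂ] D →ₗ[ℂ] ℂ} (hB : B.IsSymm)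
    (j : D →ₗ[ℂ] H) (E : ℝ) {ev : Set ℝ} {p : ev → D}
    (hp : ∀ lam : ev, p lam ∈ weakEigenspace B j lam) (s : Finset ev) :
    energy (shift B j E) (∑ lam ∈ s, p lam) = ∑ lam ∈ s, ((lam : ℝ) - E) * ‖j (p lam)‖ ^ 2 := by
  have horth : ∀ lam mu, mu ≠ lam → shift B j E (p mu) (p lam) = 0 := by
    intro lam mu hne
    have hinner := (isOrtho_formEigenspace hB j (Subtype.coe_injective.ne hne)).inner_eq
      (Submodule.mem_map_of_mem (hp mu)) (Submodule.mem_map_of_mem (hp lam))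
    rw [shift_apply, mem_weakEigenspace.1 (hp lam), hinner, mul_zero, mul_zero, sub_zero]
  have hdiag : ∀ lam, (shift B j E (p lam) (p lam)).re = ((lam : ℝ) - E) * ‖j (p lam)‖ ^ 2 := by
    intro lam
    rw [shift_apply, mem_weakEigenspace.1 (hp lam), ← sub_mul, ← Complex.ofReal_sub,
      inner_self_eq_norm_sq_to_K, Complex.re_ofReal_mul]
    norm_cast
  rw [energy, map_sum, Complex.re_sum]
  refine Finset.sum_congr rfl fun lam hlam => ?_
  rw [LinearMap.map_sum₂, Finset.sum_eq_single lam (fun mu _ hne => horth lam mu hne) (absurd hlam),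
    hdiag]

theorem energy_shift_neg_of_mem_iSup_weakEigenspace {B : D →ₗ⋆[ℂ] D →ₗ[ℂ] ℂ} (hB : B.IsSymm)
    {j : D →ₗ[ℂ] H} {E : ℝ} {p : D} (hp : p ∈ ⨆ lam : Iio E, weakEigenspace B j lam)
    (hp0 : j p ≠ 0) : energy (shift B j E) p < 0 := by
  obtain ⟨g, hg, rfl⟩ := (Submodule.mem_iSup_iff_exists_finsupp _ _).1 hp
  rw [Finsupp.sum, map_sum] at hp0
  obtain ⟨lam, hlam, hlam0⟩ := Finset.exists_ne_zero_of_sum_ne_zero hp0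
  rw [Finsupp.sum, energy_shift_sum_of_mem_weakEigenspace hB j E hg]
  exact Finset.sum_neg'
    (fun mu _ => mul_nonpos_of_nonpos_of_nonneg (sub_nonpos.2 mu.2.le) (sq_nonneg _))
    ⟨lam, hlam, mul_neg_of_neg_of_pos (sub_neg.2 lam.2) (pow_pos (norm_pos_iff.2 hlam0) 2)⟩

end SesquilinearForms

section VariationalPrinciple

/-! ### The variational principle -/

variable {D H : Type*} [AddCommGroup D] [Module ℂ D] [NormedAddCommGroup H]
  [InnerProductSpace ℂ H] {B : D →ₗ⋆[ℂ] D →ₗ[ℂ] ℂ} {j : D →ₗ[ℂ] H} {E : ℝ}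

/-- A symmetric, semibounded form whose minimizing sequences at levels below `E` are precompact.
The sequences are only required to satisfy the parallelogram estimate that holds on every subspace
on which the shifted form is nonnegative; the associated operator then has purely discrete spectrum
below `E`. -/
structure HasDiscreteSpectrumBelow (B : D →ₗ⋆[ℂ] D →ₗ[ℂ] ℂ) (j : D →ₗ[ℂ] H) (E : ℝ) :
    Prop where
  isSymm : B.IsSymm
  semibounded : ∃ C : ℝ, ∀ p, C * ‖j p‖ ^ 2 ≤ energy B p
  precompact : ∀ lam < E, ∀ x : ℕ → D, (∀ n, ‖j (x n)‖ = 1) →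
    Tendsto (fun n => energy (shift B j lam) (x n)) atTop (𝓝 0) →
    (∀ n m, energy (shift B j lam) (x n - x m) ≤
      2 * (energy (shift B j lam) (x n) + energy (shift B j lam) (x m))) →
    ∃ (y : D) (φ : ℕ → ℕ), Tendsto (fun n => j (x (φ n))) atTop (𝓝 (j y)) ∧
      energy (shift B j lam) y ≤ 0

namespace HasDiscreteSpectrumBelow

theorem norm_pos_of_energy_shift_neg (h : HasDiscreteSpectrumBelow B j E) {lam : ℝ} {p : D}
    (hp : energy (shift B j lam) p < 0) : 0 < ‖j p‖ := by
  refine (norm_nonneg _).lt_of_ne' fun hp0 => hp.not_ge ?_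
  obtain ⟨C, hC⟩ := h.semibounded
  simpa [energy_shift, hp0] using hC p

theorem exists_minimizing_seq (h : HasDiscreteSpectrumBelow B j E) {X : Submodule ℂ D} {p : D}
    (hpX : p ∈ X) (hp : energy (shift B j E) p < 0) :
    ∃ lam < E, (∀ q ∈ X, 0 ≤ energy (shift B j lam) q) ∧
      ∃ x : ℕ → D, (∀ n, x n ∈ X) ∧ (∀ n, ‖j (x n)‖ = 1) ∧
        Tendsto (fun n => energy (shift B j lam) (x n)) atTop (𝓝 0) := by
  let S : Set ℝ := {r | ∃ q ∈ X, ‖j q‖ = 1 ∧ energy B q = r}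
  have hbdd : BddBelow S := by
    obtain ⟨C, hC⟩ := h.semibounded
    refine ⟨C, ?_⟩
    rintro _ ⟨q, -, hq, rfl⟩
    simpa [hq] using hC q
  have hnormalize : ∀ q ∈ X, ∀ lam, energy (shift B j lam) q < 0 → ∃ r ∈ S, r < lam := by
    intro q hq lam hneg
    have hq0 := h.norm_pos_of_energy_shift_neg hneg
    have hnorm : ‖j (((‖j q‖⁻¹ : ℝ) : ℂ) • q)‖ = 1 := by
      rw [map_smul, norm_smul, Complex.norm_real, norm_inv, norm_norm, inv_mul_cancel₀ hq0.ne']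
    refine ⟨_, ⟨_, X.smul_mem _ hq, hnorm, rfl⟩, ?_⟩
    have hscaled := energy_smul (shift B j lam) ((‖j q‖⁻¹ : ℝ) : ℂ) q
    rw [energy_shift, hnorm, one_pow, mul_one] at hscaled
    have : ‖((‖j q‖⁻¹ : ℝ) : ℂ)‖ ^ 2 * energy (shift B j lam) q < 0 :=
      mul_neg_of_pos_of_neg
        (by rw [Complex.norm_real, norm_inv, norm_norm]; exact pow_pos (inv_pos.2 hq0) 2) hneg
    linarith
  obtain ⟨r₀, hr₀S, hr₀⟩ := hnormalize p hpX E hp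
  obtain ⟨r, -, hr, hrS⟩ := exists_seq_tendsto_sInf ⟨r₀, hr₀S⟩ hbdd
  choose x hxX hx1 hxr using hrS
  refine ⟨sInf S, (csInf_le hbdd hr₀S).trans_lt hr₀, fun q hq => ?_, x, hxX, hx1, ?_⟩
  · by_contra! hneg
    obtain ⟨s, hsS, hs⟩ := hnormalize q hq _ hneg
    exact hs.not_ge (csInf_le hbdd hsS)
  · simpa [energy_shift, hx1, hxr] using hr.sub_const (sInf S)

theorem exists_minimizer (h : HasDiscreteSpectrumBelow B j E) {K : Submodule ℂ H}
    (hK : IsClosed (K : Set H)) {p : D} (hpK : j p ∈ K) (hp : energy (shift B j E) p < 0) :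
    ∃ lam < E, (∀ q, j q ∈ K → 0 ≤ energy (shift B j lam) q) ∧
      ∃ y, j y ∈ K ∧ ‖j y‖ = 1 ∧ energy (shift B j lam) y = 0 := by
  obtain ⟨lam, hlam, hnonneg, x, hxK, hx1, hx⟩ :=
    h.exists_minimizing_seq (X := K.comap j) hpK hp
  have hpar : ∀ n m, energy (shift B j lam) (x n - x m) ≤
      2 * (energy (shift B j lam) (x n) + energy (shift B j lam) (x m)) := by
    intro n m
    have hsum := hnonneg _ (add_mem (hxK n) (hxK m))
    linarith [energy_add_add_energy_sub (shift B j lam) (x n) (x m)]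
  obtain ⟨y, φ, hy, hyle⟩ := h.precompact lam hlam x hx1 hx hpar
  have hyK : j y ∈ K := hK.mem_of_tendsto hy (Eventually.of_forall fun n => hxK (φ n))
  have hy1 : ‖j y‖ = 1 := tendsto_nhds_unique hy.norm (by simp only [hx1, tendsto_const_nhds])
  exact ⟨lam, hlam, hnonneg, y, hyK, hy1, hyle.antisymm (hnonneg y hyK)⟩

end HasDiscreteSpectrumBelow

theorem mem_formEigenspace_of_orthogonal_invariant (hB : B.IsSymm) {F : Submodule ℂ H}
    [F.HasOrthogonalProjection] (hF : ∀ f ∈ F, ∃ g ∈ F, Represents B j f g) {lam : ℝ} {y : D}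
    (hy : j y ∈ Fᗮ) (hnull : ∀ q, j q ∈ Fᗮ → shift B j lam q y = 0) :
    j y ∈ formEigenspace B j lam := by
  refine Submodule.mem_map_of_mem (mem_weakEigenspace.2 fun q => ?_)
  have hyF : ∀ f ∈ F, inner ℂ (j y) f = 0 := fun f hf =>
    Submodule.inner_left_of_mem_orthogonal hf hy
  obtain ⟨g, hg, w, hwf, hwg⟩ := hF _ (F.starProjection_apply_mem (j q))
  have hperp : shift B j lam (q - w) y = 0 := by
    refine hnull _ ?_
    rw [map_sub, hwf]
    exact F.sub_starProjection_mem_orthogonal _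
  have hpar : shift B j lam w y = 0 := by
    rw [← (shift_isSymm hB j lam).eq, shift_apply, hwg, hyF g hg, hwf,
      hyF _ (F.starProjection_apply_mem _), mul_zero, sub_zero, map_zero]
  rwa [map_sub, LinearMap.sub_apply, hpar, sub_zero, shift_apply, sub_eq_zero] at hperp

theorem HasDiscreteSpectrumBelow.energy_shift_nonneg_of_mem_orthogonal
    (h : HasDiscreteSpectrumBelow B j E) [(spectralSubspace B j E).HasOrthogonalProjection]
    {p : D} (hp : j p ∈ (spectralSubspace B j E)ᗮ) : 0 ≤ energy (shift B j E) p := by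
  by_contra! hneg
  obtain ⟨lam, hlam, hnonneg, y, hyF, hy1, hy0⟩ :=
    h.exists_minimizer (Submodule.isClosed_orthogonal _) hp hneg
  have hnull : ∀ q, j q ∈ (spectralSubspace B j E)ᗮ → shift B j lam q y = 0 := fun q hq =>
    apply_eq_zero_of_energy_eq_zero (shift_isSymm h.isSymm j lam)
      (X := (spectralSubspace B j E)ᗮ.comap j) hnonneg hq hyF hy0
  have heigen := mem_formEigenspace_of_orthogonal_invariant h.isSymm
    (fun _ => exists_represents_of_mem_spectralSubspace) hyF hnull
  have hself : inner ℂ (j y) (j y) = 0 := Submodule.inner_left_of_mem_orthogonal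
    (formEigenspace_le_spectralSubspace B j hlam heigen) hyF
  rw [inner_self_eq_zero.1 hself, norm_zero] at hy1
  exact zero_ne_one hy1

end VariationalPrinciple

section Counting

/-! ### Counting eigenvalues -/

theorem toENNReal_toENat_cardinalSum {α : Type*} (c : α → Cardinal) :
    ((Cardinal.toENat (Cardinal.sum c) : ℕ∞) : ℝ≥0∞) = ∑' a, (Cardinal.toENat (c a) : ℝ≥0∞) := by
  have hcard : ∀ a, Cardinal.toENat (c a) = ENat.card (c a).out := fun a => by
    rw [ENat.card, Cardinal.mk_out]
  have hsum : Cardinal.sum c = Cardinal.mk (Σ a, (c a).out) := by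
    simp only [Cardinal.mk_sigma, Cardinal.mk_out]
  calc ((Cardinal.toENat (Cardinal.sum c) : ℕ∞) : ℝ≥0∞) = ENat.card (Σ a, (c a).out) := by
        rw [hsum, ENat.card]
    _ = ∑' a, (ENat.card (c a).out : ℝ≥0∞) := by
        simp only [← ENNReal.tsum_one, ENNReal.tsum_sigma']
    _ = ∑' a, (Cardinal.toENat (c a) : ℝ≥0∞) := by simp only [hcard]

theorem rank_iSup_of_iSupIndep.{u, v} {K : Type*} {M : Type u} {α : Type v}
    [DivisionRing K] [AddCommGroup M] [Module K M] {S : α → Submodule K M} (hS : iSupIndep S) :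
    Cardinal.lift (Module.rank K (⨆ a, S a : Submodule K M)) =
      Cardinal.sum fun a => Module.rank K (S a) := by
  classical
  have hinj : Function.Injective (DirectSum.coeLinearMap S) := hS.dfinsupp_lsum_injective
  rw [← rank_directSum, Submodule.iSup_eq_range_dfinsupp_lsum]
  have hrank := (LinearEquiv.ofInjective _ hinj).lift_rank_eq
  rw [Cardinal.lift_umax.{u, v}, Cardinal.lift_id'.{u, v}] at hrank
  exact hrank.symm

variable {D H : Type*} [AddCommGroup D] [Module ℂ D] [NormedAddCommGroup H]
  [InnerProductSpace ℂ H]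

/-- The number of eigenvalues below `E`, counted with multiplicity, of the operator associated with
`B` and `j`. -/
def formCount (B : D →ₗ⋆[ℂ] D →ₗ[ℂ] ℂ) (j : D →ₗ[ℂ] H) (E : ℝ) : ℕ∞ :=
  Cardinal.toENat (Module.rank ℂ (spectralSubspace B j E))

theorem formCount_mono (B : D →ₗ⋆[ℂ] D →ₗ[ℂ] ℂ) (j : D →ₗ[ℂ] H) : Monotone (formCount B j) :=
  fun _ _ hE => OrderHomClass.mono Cardinal.toENat
    (Submodule.rank_mono (spectralSubspace_mono B j hE))

theorem toENNReal_formCount {B : D →ₗ⋆[ℂ] D →ₗ[ℂ] ℂ} (hB : B.IsSymm) (j : D →ₗ[ℂ] H) (E : ℝ) :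
    (formCount B j E : ℝ≥0∞) =
      ∑' lam : Iio E, (Cardinal.toENat (Module.rank ℂ (formEigenspace B j lam)) : ℝ≥0∞) := by
  have hfam : OrthogonalFamily ℂ (fun lam : Iio E => formEigenspace B j lam)
      fun lam => (formEigenspace B j lam).subtypeₗᵢ :=
    OrthogonalFamily.of_pairwise fun lam mu hne =>
      isOrtho_formEigenspace hB j (Subtype.coe_injective.ne hne)
  rw [← toENNReal_toENat_cardinalSum, ← rank_iSup_of_iSupIndep hfam.independent,
    Cardinal.toENat_lift]
  rfl

theorem exists_energy_neg_of_natCast_le_formCount {B : D →ₗ⋆[ℂ] D →ₗ[ℂ] ℂ} (hB : B.IsSymm)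
    {j : D →ₗ[ℂ] H} {E : ℝ} {k : ℕ} (hk : k ≤ formCount B j E) :
    ∃ f : Fin k → D, ∀ a : Fin k → ℂ, a ≠ 0 → energy (shift B j E) (∑ i, a i • f i) < 0 := by
  rw [formCount, Cardinal.natCast_le_toENat, Module.le_rank_iff] at hk
  obtain ⟨v, hv⟩ := hk
  have hlift : ∀ i, ∃ p ∈ ⨆ lam : Iio E, weakEigenspace B j lam, j p = v i := fun i => by
    rw [← Submodule.mem_map, Submodule.map_iSup]
    exact (v i).2
  choose f hf hfv using hlift
  refine ⟨f, fun a ha => energy_shift_neg_of_mem_iSup_weakEigenspace hB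
    (sum_mem fun i _ => Submodule.smul_mem _ _ (hf i)) fun h0 => ha ?_⟩
  refine funext (Fintype.linearIndependent_iff.1 hv a (Subtype.ext ?_))
  simpa [hfv] using h0

theorem natCast_le_sum_formCount {κ : Type*} [Fintype κ] {D H : κ → Type*}
    [∀ c, AddCommGroup (D c)] [∀ c, Module ℂ (D c)] [∀ c, NormedAddCommGroup (H c)]
    [∀ c, InnerProductSpace ℂ (H c)] {B : ∀ c, D c →ₗ⋆[ℂ] D c →ₗ[ℂ] ℂ} {j : ∀ c, D c →ₗ[ℂ] H c}
    {E : ℝ} (h : ∀ c, HasDiscreteSpectrumBelow (B c) (j c) E) {k : ℕ} (f : ∀ c, Fin k → D c)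
    (hf : ∀ a : Fin k → ℂ, a ≠ 0 → ∑ c, energy (shift (B c) (j c) E) (∑ i, a i • f c i) < 0) :
    k ≤ ∑ c, formCount (B c) (j c) E := by
  by_cases htop : ∃ c, formCount (B c) (j c) E = ⊤
  · obtain ⟨c, hc⟩ := htop
    exact le_top.trans (hc ▸ Finset.single_le_sum (f := fun c => formCount (B c) (j c) E)
      (fun _ _ => zero_le) (Finset.mem_univ c))
  push Not at htop
  have hfin : ∀ c, FiniteDimensional ℂ (spectralSubspace (B c) (j c) E) := fun c => by
    rw [FiniteDimensional, ← Module.rank_lt_aleph0_iff, ← Cardinal.toENat_lt_top]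
    exact (htop c).lt_top
  have hcount : ∀ c, formCount (B c) (j c) E =
      Module.finrank ℂ (spectralSubspace (B c) (j c) E) := fun c => by
    rw [formCount, ← Module.finrank_eq_rank, map_natCast]
  simp only [hcount]
  rw [← Nat.cast_sum, Nat.cast_le]
  by_contra! hlt
  let L : (Fin k → ℂ) →ₗ[ℂ] ∀ c, spectralSubspace (B c) (j c) E := LinearMap.pi fun c =>
    (spectralSubspace (B c) (j c) E).orthogonalProjectionOnto.toLinearMap ∘ₗ j c ∘ₗ
      Fintype.linearCombination ℂ (f c)
  have hker : L.ker ≠ ⊥ := LinearMap.ker_ne_bot_of_finrank_lt (by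
    rwa [Module.finrank_pi_fintype, Module.finrank_fin_fun])
  obtain ⟨a, ha, ha0⟩ := (Submodule.ne_bot_iff _).1 hker
  have horth : ∀ c, j c (∑ i, a i • f c i) ∈ (spectralSubspace (B c) (j c) E)ᗮ := fun c => by
    rw [← Submodule.orthogonalProjectionOnto_eq_zero_iff]
    exact congrFun (LinearMap.mem_ker.1 ha) c
  exact (hf a ha0).not_ge (Finset.sum_nonneg fun c _ =>
    (h c).energy_shift_nonneg_of_mem_orthogonal (horth c))

theorem HasDiscreteSpectrumBelow.natCast_le_formCount_iff {B : D →ₗ⋆[ℂ] D →ₗ[ℂ] ℂ}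
    {j : D →ₗ[ℂ] H} {E : ℝ} (h : HasDiscreteSpectrumBelow B j E) {k : ℕ} :
    k ≤ formCount B j E ↔ ∃ f : Fin k → D, ∀ a : Fin k → ℂ, a ≠ 0 →
      energy (shift B j E) (∑ i, a i • f i) < 0 := by
  refine ⟨exists_energy_neg_of_natCast_le_formCount h.isSymm, fun ⟨f, hf⟩ => ?_⟩
  simpa using natCast_le_sum_formCount (κ := Unit) (fun _ => h) (fun _ => f) (by simpa using hf)

end Counting

section WeightedInner

/-! ### The form domain and the form -/

variable {w : ℝ → ℝ} {u v v' : HalfLineL2}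

/-- The functions `u` in `L²(0, ∞)` with `∫ |w| |u|² dx < ∞`. -/
def weightedL2 (hw : AEStronglyMeasurable w halfLineMeasure) : Submodule ℂ HalfLineL2 where
  carrier := {u | Integrable (fun x => |w x| * ‖u x‖ ^ 2) halfLineMeasure}
  add_mem' {u v} hu hv := by
    refine ((hu.const_mul 2).add (hv.const_mul 2)).mono'
      (hw.norm.mul ((aestronglyMeasurable_coe _).norm.pow 2)) ?_
    filter_upwards [Lp.coeFn_add u v] with x hx
    rw [hx, Real.norm_of_nonneg (by positivity)]
    simp only [Pi.add_apply]
    nlinarith [norm_add_sq_le_two_mul (u x) (v x), abs_nonneg (w x)]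
  zero_mem' := by
    refine (integrable_zero ℝ ℝ halfLineMeasure).congr ?_
    filter_upwards [Lp.coeFn_zero ℂ 2 halfLineMeasure] with x hx
    have hx' : (0 : HalfLineL2) x = 0 := hx
    simp only [hx', norm_zero, ne_eq, OfNat.ofNat_ne_zero, not_false_eq_true, zero_pow, mul_zero,
      Pi.zero_apply]
  smul_mem' k u hu := by
    refine (hu.const_mul (‖k‖ ^ 2)).congr ?_
    filter_upwards [Lp.coeFn_smul k u] with x hx
    rw [hx, Pi.smul_apply, norm_smul]
    ring

theorem mem_weightedL2 {hw : AEStronglyMeasurable w halfLineMeasure} :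
    u ∈ weightedL2 hw ↔ Integrable (fun x => |w x| * ‖u x‖ ^ 2) halfLineMeasure := Iff.rfl

theorem integrable_mul_norm_sq_of_mem_weightedL2 {hw : AEStronglyMeasurable w halfLineMeasure}
    (hu : u ∈ weightedL2 hw) : Integrable (fun x => w x * ‖u x‖ ^ 2) halfLineMeasure := by
  refine hu.mono (hw.mul ((aestronglyMeasurable_coe u).norm.pow 2)) (.of_forall fun x => ?_)
  simp only [norm_mul, Real.norm_eq_abs, abs_abs, le_refl]

theorem integrable_weighted_mul {hw : AEStronglyMeasurable w halfLineMeasure}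
    (hu : u ∈ weightedL2 hw) (hv : v ∈ weightedL2 hw) :
    Integrable (fun x => (w x : ℂ) * conj (u x) * v x) halfLineMeasure := by
  refine (hu.add hv).mono' (((Complex.continuous_ofReal.comp_aestronglyMeasurable hw).mul
    (Complex.continuous_conj.comp_aestronglyMeasurable (aestronglyMeasurable_coe u))).mul
    (aestronglyMeasurable_coe v)) (.of_forall fun x => ?_)
  have hprod : ‖u x‖ * ‖v x‖ ≤ ‖u x‖ ^ 2 + ‖v x‖ ^ 2 := by
    nlinarith [sq_nonneg (‖u x‖ - ‖v x‖), mul_nonneg (norm_nonneg (u x)) (norm_nonneg (v x))]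
  calc ‖(w x : ℂ) * conj (u x) * v x‖ = |w x| * (‖u x‖ * ‖v x‖) := by
        rw [norm_mul, norm_mul, Complex.norm_real, RCLike.norm_conj, Real.norm_eq_abs, mul_assoc]
    _ ≤ |w x| * (‖u x‖ ^ 2 + ‖v x‖ ^ 2) := mul_le_mul_of_nonneg_left hprod (abs_nonneg _)
    _ = |w x| * ‖u x‖ ^ 2 + |w x| * ‖v x‖ ^ 2 := mul_add _ _ _

/-- `∫ w conj(u) v dx`, the contribution of one edge to the potential part of the form. -/
def weightedInner (w : ℝ → ℝ) (u v : HalfLineL2) : ℂ :=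
  ∫ x in Ioi (0 : ℝ), (w x : ℂ) * conj (u x) * v x

theorem weightedInner_add_right {hw : AEStronglyMeasurable w halfLineMeasure}
    (hu : u ∈ weightedL2 hw) (hv : v ∈ weightedL2 hw) (hv' : v' ∈ weightedL2 hw) :
    weightedInner w u (v + v') = weightedInner w u v + weightedInner w u v' := by
  rw [weightedInner, weightedInner, weightedInner,
    ← integral_add (integrable_weighted_mul hu hv) (integrable_weighted_mul hu hv')]
  refine integral_congr_ae ?_
  filter_upwards [Lp.coeFn_add v v'] with x hx
  rw [hx, Pi.add_apply, mul_add]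

theorem weightedInner_smul_right (w : ℝ → ℝ) (k : ℂ) (u v : HalfLineL2) :
    weightedInner w u (k • v) = k * weightedInner w u v := by
  rw [weightedInner, weightedInner, ← integral_const_mul]
  refine integral_congr_ae ?_
  filter_upwards [Lp.coeFn_smul k v] with x hx
  rw [hx, Pi.smul_apply, smul_eq_mul]
  ring

theorem conj_weightedInner (w : ℝ → ℝ) (u v : HalfLineL2) :
    conj (weightedInner w u v) = weightedInner w v u := by
  rw [weightedInner, weightedInner, ← integral_conj]
  refine integral_congr_ae (.of_forall fun x => ?_)
  simp only [map_mul, Complex.conj_ofReal, Complex.conj_conj]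
  ring

theorem weightedInner_self (w : ℝ → ℝ) (u : HalfLineL2) :
    weightedInner w u u = ((∫ x in Ioi (0 : ℝ), w x * ‖u x‖ ^ 2 : ℝ) : ℂ) := by
  rw [weightedInner, ← integral_complex_ofReal]
  refine integral_congr_ae (.of_forall fun x => ?_)
  simp only [mul_assoc, Complex.conj_mul', Complex.ofReal_mul, Complex.ofReal_pow]

end WeightedInner

namespace IsPotential

variable {ι : Type} {V : ι → ℝ → ℝ}

theorem aestronglyMeasurable_posPart (hV : IsPotential V) (i : ι) :
    AEStronglyMeasurable (fun x => (V i x)⁺) halfLineMeasure := by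
  have hunion : Ioi (0 : ℝ) = ⋃ n : ℕ, Ioc (0 : ℝ) n := by
    ext x
    simp only [mem_Ioi, mem_iUnion, mem_Ioc, exists_and_left, exists_nat_ge x, and_true]
  rw [halfLineMeasure, hunion, aestronglyMeasurable_iUnion_iff]
  exact fun n => (hV.posPart_loc i n).aestronglyMeasurable

theorem aestronglyMeasurable (hV : IsPotential V) (i : ι) :
    AEStronglyMeasurable (V i) halfLineMeasure := by
  obtain ⟨p, -, -, hp⟩ := hV.negPart_memLp
  have hsplit : V i = (fun x => (V i x)⁺) - fun x => (V i x)⁻ :=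
    funext fun x => (posPart_sub_negPart _).symm
  rw [hsplit]
  exact (hV.aestronglyMeasurable_posPart i).sub (hp i).aestronglyMeasurable

/-- The part of the negative part of the potential exceeding `ε`. It is integrable for `ε > 0`, so
up to a bounded error the negative part may be treated as an integrable function. -/
def excess (V : ι → ℝ → ℝ) (ε : ℝ) (i : ι) (x : ℝ) : ℝ := max ((V i x)⁻ - ε) 0

theorem excess_nonneg (V : ι → ℝ → ℝ) (ε : ℝ) (i : ι) (x : ℝ) : 0 ≤ excess V ε i x :=
  le_max_right _ _

theorem negPart_le_add_excess (V : ι → ℝ → ℝ) (ε : ℝ) (i : ι) (x : ℝ) :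
    (V i x)⁻ ≤ ε + excess V ε i x :=
  sub_le_iff_le_add'.1 (le_max_left _ _)

theorem posPart_le_add_excess (V : ι → ℝ → ℝ) (ε : ℝ) (i : ι) (x : ℝ) :
    (V i x)⁺ ≤ V i x + ε + excess V ε i x := by
  linarith [negPart_le_add_excess V ε i x, posPart_sub_negPart (V i x)]

theorem integrable_excess (hV : IsPotential V) {ε : ℝ} (hε : 0 < ε) (i : ι) :
    Integrable (excess V ε i) halfLineMeasure := by
  obtain ⟨p, hp1, hp, hLp⟩ := hV.negPart_memLp
  set s := toMeasurable halfLineMeasure {x | ε.toNNReal ≤ ‖(V i x)⁻‖₊}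
  have hfin : halfLineMeasure s < ∞ := by
    rw [measure_toMeasurable]
    exact (hLp i).meas_ge_lt_top (by positivity) hp (by simpa using hε)
  have : IsFiniteMeasure (halfLineMeasure.restrict s) :=
    ⟨by rwa [Measure.restrict_apply_univ]⟩
  have hind : Integrable (s.indicator fun x => (V i x)⁻) halfLineMeasure :=
    (integrable_indicator_iff (measurableSet_toMeasurable _ _)).2
      (((hLp i).restrict s).integrable hp1)
  refine hind.mono' (((hLp i).aestronglyMeasurable.aemeasurable.sub_const ε).max
    aemeasurable_const).aestronglyMeasurable (.of_forall fun x => ?_)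
  rw [Real.norm_of_nonneg (excess_nonneg V ε i x)]
  by_cases hx : x ∈ s
  · rw [indicator_of_mem hx]
    exact max_le (sub_le_self _ hε.le) (negPart_nonneg _)
  · have hlt : ¬ ε.toNNReal ≤ ‖(V i x)⁻‖₊ := fun h => hx (subset_toMeasurable _ _ h)
    rw [not_le, ← NNReal.coe_lt_coe, coe_nnnorm, Real.norm_of_nonneg (negPart_nonneg _),
      Real.coe_toNNReal _ hε.le] at hlt
    rw [indicator_of_notMem hx, excess, max_eq_right (sub_nonpos.2 hlt.le)]

theorem mem_weightedL2_of_posPart (hV : IsPotential V) {i : ι} {u u' : HalfLineL2} {c : ℂ}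
    (hu : HasDerivTrace u u' c)
    (hpos : Integrable (fun x => (V i x)⁺ * ‖u x‖ ^ 2) halfLineMeasure) :
    u ∈ weightedL2 (hV.aestronglyMeasurable i) := by
  refine ((hpos.add (hu.integrable_mul_norm_sq (hV.integrable_excess one_pos i))).add
    (integrable_norm_sq u)).mono' ((hV.aestronglyMeasurable i).norm.mul
    ((aestronglyMeasurable_coe u).norm.pow 2)) (.of_forall fun x => ?_)
  rw [Real.norm_of_nonneg (by positivity), ← posPart_add_negPart]
  simp only [Pi.add_apply]
  nlinarith [negPart_le_add_excess V 1 i x, sq_nonneg ‖u x‖]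

end IsPotential

section FormDomain

variable {ι : Type} [Fintype ι] {V : ι → ℝ → ℝ}

/-- The form domain as a space of pairs `(ψ, ψ')`. Since `V₋` is form bounded, one may ask for
`∫ |V| |ψ|² < ∞` instead of `∫ V₊ |ψ|² < ∞`. -/
def domain (hV : IsPotential V) : Submodule ℂ (StarL2 ι × StarL2 ι) where
  carrier := {p | HasStarDeriv p.1 p.2 ∧ ∀ i, p.1 i ∈ weightedL2 (hV.aestronglyMeasurable i)}
  add_mem' := by
    rintro p q ⟨⟨c, hc⟩, hp⟩ ⟨⟨d, hd⟩, hq⟩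
    exact ⟨⟨c + d, fun i => (hc i).add (hd i)⟩, fun i => add_mem (hp i) (hq i)⟩
  zero_mem' := ⟨⟨0, fun _ => .zero⟩, fun _ => zero_mem _⟩
  smul_mem' := by
    rintro k p ⟨⟨c, hc⟩, hp⟩
    exact ⟨⟨k * c, fun i => (hc i).smul k⟩, fun i => Submodule.smul_mem _ k (hp i)⟩

theorem mem_domain_of_posPart (hV : IsPotential V) {p : StarL2 ι × StarL2 ι}
    (hp : HasStarDeriv p.1 p.2)
    (hpos : ∀ i, Integrable (fun x => (V i x)⁺ * ‖p.1 i x‖ ^ 2) halfLineMeasure) :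
    p ∈ domain hV := by
  obtain ⟨c, hc⟩ := hp
  exact ⟨⟨c, hc⟩, fun i => hV.mem_weightedL2_of_posPart (hc i) (hpos i)⟩

theorem FormDomain.mem_domain (hV : IsPotential V) (ψ : FormDomain V) :
    (ψ.toL2, ψ.deriv) ∈ domain hV := by
  refine mem_domain_of_posPart hV ψ.hasStarDeriv fun i =>
    ⟨(hV.aestronglyMeasurable_posPart i).mul ((aestronglyMeasurable_coe _).norm.pow 2), ?_⟩
  rw [hasFiniteIntegral_iff_ofReal (.of_forall fun x =>
    mul_nonneg (posPart_nonneg _) (sq_nonneg _))]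
  exact ψ.lintegral_posPart_lt_top i

theorem integrable_posPart_mul_norm_sq {hV : IsPotential V} (p : domain hV) (i : ι) :
    Integrable (fun x => (V i x)⁺ * ‖p.1.1 i x‖ ^ 2) halfLineMeasure := by
  refine (p.2.2 i).mono' ((hV.aestronglyMeasurable_posPart i).mul
    ((aestronglyMeasurable_coe _).norm.pow 2)) (.of_forall fun x => ?_)
  rw [Real.norm_of_nonneg (mul_nonneg (posPart_nonneg _) (sq_nonneg _))]
  refine mul_le_mul_of_nonneg_right ?_ (sq_nonneg _)
  rw [← posPart_add_negPart]
  exact le_add_of_nonneg_right (negPart_nonneg _)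

/-- The element of `FormDomain V` given by a pair `(ψ, ψ')`. -/
def toFormDomain {hV : IsPotential V} (p : domain hV) : FormDomain V where
  toL2 := p.1.1
  deriv := p.1.2
  hasStarDeriv := p.2.1
  lintegral_posPart_lt_top i := by
    rw [← hasFiniteIntegral_iff_ofReal (.of_forall fun x =>
      mul_nonneg (posPart_nonneg _) (sq_nonneg _))]
    exact (integrable_posPart_mul_norm_sq p i).2

theorem form_toFormDomain {hV : IsPotential V} (p q : domain hV) :
    form V (toFormDomain p) (toFormDomain q) =
      inner ℂ p.1.2 q.1.2 + ∑ i, weightedInner (V i) (p.1.1 i) (q.1.1 i) := rfl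

theorem conj_form_toFormDomain {hV : IsPotential V} (p q : domain hV) :
    conj (form V (toFormDomain p) (toFormDomain q)) =
      form V (toFormDomain q) (toFormDomain p) := by
  simp only [form_toFormDomain, map_add, map_sum, inner_conj_symm, conj_weightedInner]

theorem form_toFormDomain_add_right {hV : IsPotential V} (p q q' : domain hV) :
    form V (toFormDomain p) (toFormDomain (q + q')) =
      form V (toFormDomain p) (toFormDomain q) + form V (toFormDomain p) (toFormDomain q') := by
  have hpot : ∀ i, weightedInner (V i) (p.1.1 i) ((q + q').1.1 i) =
      weightedInner (V i) (p.1.1 i) (q.1.1 i) + weightedInner (V i) (p.1.1 i) (q'.1.1 i) :=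
    fun i => weightedInner_add_right (p.2.2 i) (q.2.2 i) (q'.2.2 i)
  have hinner : inner ℂ p.1.2 (q + q').1.2 = inner ℂ p.1.2 q.1.2 + inner ℂ p.1.2 q'.1.2 :=
    inner_add_right _ _ _
  rw [form_toFormDomain, hinner, Finset.sum_congr rfl fun i _ => hpot i, Finset.sum_add_distrib,
    form_toFormDomain, form_toFormDomain, add_add_add_comm]

theorem form_toFormDomain_smul_right {hV : IsPotential V} (k : ℂ) (p q : domain hV) :
    form V (toFormDomain p) (toFormDomain (k • q)) =
      k * form V (toFormDomain p) (toFormDomain q) := by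
  have hpot : ∀ i, weightedInner (V i) (p.1.1 i) ((k • q).1.1 i) =
      k * weightedInner (V i) (p.1.1 i) (q.1.1 i) :=
    fun i => weightedInner_smul_right (V i) k (p.1.1 i) (q.1.1 i)
  have hinner : inner ℂ p.1.2 (k • q).1.2 = k * inner ℂ p.1.2 q.1.2 := inner_smul_right _ _ _
  rw [form_toFormDomain, hinner, Finset.sum_congr rfl fun i _ => hpot i, ← Finset.mul_sum,
    form_toFormDomain, mul_add]

/-- `form V` as a sesquilinear form on `domain hV`. -/
def sesqForm (hV : IsPotential V) : domain hV →ₗ⋆[ℂ] domain hV →ₗ[ℂ] ℂ :=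
  LinearMap.mk₂'ₛₗ (starRingEnd ℂ) (RingHom.id ℂ)
    (fun p q => form V (toFormDomain p) (toFormDomain q))
    (fun p p' q => by
      rw [← conj_form_toFormDomain, form_toFormDomain_add_right, map_add, conj_form_toFormDomain,
        conj_form_toFormDomain])
    (fun k p q => by
      rw [← conj_form_toFormDomain, form_toFormDomain_smul_right, map_mul, conj_form_toFormDomain,
        smul_eq_mul])
    form_toFormDomain_add_right
    form_toFormDomain_smul_right

theorem sesqForm_isSymm (hV : IsPotential V) : (sesqForm hV).IsSymm :=
  ⟨conj_form_toFormDomain⟩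

theorem energy_sesqForm {hV : IsPotential V} (p : domain hV) :
    energy (sesqForm hV) p =
      ‖p.1.2‖ ^ 2 + ∑ i, ∫ x in Ioi (0 : ℝ), V i x * ‖p.1.1 i x‖ ^ 2 := by
  change (form V (toFormDomain p) (toFormDomain p)).re = _
  rw [form_toFormDomain, inner_self_eq_norm_sq_to_K]
  simp only [weightedInner_self]
  norm_cast

/-- The embedding of the form domain into `L²`. -/
def embed (hV : IsPotential V) : domain hV →ₗ[ℂ] StarL2 ι :=
  (LinearMap.fst ℂ (StarL2 ι) (StarL2 ι)).comp (domain hV).subtype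

theorem embed_apply {hV : IsPotential V} (p : domain hV) : embed hV p = p.1.1 := rfl

theorem isSchrodinger_iff (hV : IsPotential V) {u f : StarL2 ι} :
    IsSchrodinger V u f ↔ Represents (sesqForm hV) (embed hV) u f := by
  constructor
  · rintro ⟨ψ, rfl, h⟩
    exact ⟨⟨_, ψ.mem_domain hV⟩, rfl, fun q => h (toFormDomain q)⟩
  · rintro ⟨p, rfl, h⟩
    exact ⟨toFormDomain p, rfl, fun φ => h ⟨_, φ.mem_domain hV⟩⟩

theorem eigenspace_eq_formEigenspace (hV : IsPotential V) (lam : ℝ) :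
    eigenspace V lam = formEigenspace (sesqForm hV) (embed hV) lam := by
  have hset : {u | IsSchrodinger V u ((lam : ℂ) • u)} =
      (formEigenspace (sesqForm hV) (embed hV) lam : Set (StarL2 ι)) :=
    Set.ext fun u => (isSchrodinger_iff hV).trans mem_formEigenspace.symm
  rw [eigenspace, hset, Submodule.span_eq]

/-- The number of eigenvalues of the Schrödinger operator below `E`, counted with multiplicity. -/
def count (hV : IsPotential V) (E : ℝ) : ℕ∞ := formCount (sesqForm hV) (embed hV) E

theorem toENNReal_count (hV : IsPotential V) (E : ℝ) :
    (count hV E : ℝ≥0∞) = ∑' lam : Iio E, (multiplicity V lam : ℝ≥0∞) := by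
  rw [count, toENNReal_formCount (sesqForm_isSymm hV)]
  refine tsum_congr fun lam => ?_
  rw [multiplicity, eigenspace_eq_formEigenspace hV]

end FormDomain

section Truncation

/-! ### Semiboundedness and closedness of the form -/

variable {ι : Type} [Fintype ι] {V : ι → ℝ → ℝ}

/-- The energy of the excess of the negative part of the potential over `ε`. -/
def excessEnergy (V : ι → ℝ → ℝ) (ε : ℝ) (u : StarL2 ι) : ℝ :=
  ∑ i, ∫ x in Ioi (0 : ℝ), IsPotential.excess V ε i x * ‖u i x‖ ^ 2

/-- The integrand of the potential energy of `u`, once the potential is raised to the nonnegative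
function `V + ε + excess V ε`. -/
def truncatedDensity (V : ι → ℝ → ℝ) (ε : ℝ) (u : StarL2 ι) (x : ℝ) : ℝ :=
  ∑ i, (V i x + ε + IsPotential.excess V ε i x) * ‖u i x‖ ^ 2

theorem posPart_mul_norm_sq_le_truncatedDensity (V : ι → ℝ → ℝ) (ε : ℝ) (u : StarL2 ι) (i : ι)
    (x : ℝ) : (V i x)⁺ * ‖u i x‖ ^ 2 ≤ truncatedDensity V ε u x := by
  have hnonneg : ∀ k, 0 ≤ (V k x + ε + IsPotential.excess V ε k x) * ‖u k x‖ ^ 2 := fun k =>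
    mul_nonneg ((posPart_nonneg _).trans (IsPotential.posPart_le_add_excess V ε k x)) (sq_nonneg _)
  refine le_trans ?_ (Finset.single_le_sum (fun k _ => hnonneg k) (Finset.mem_univ i))
  exact mul_le_mul_of_nonneg_right (IsPotential.posPart_le_add_excess V ε i x) (sq_nonneg _)

theorem truncatedDensity_nonneg (V : ι → ℝ → ℝ) (ε : ℝ) (u : StarL2 ι) (x : ℝ) :
    0 ≤ truncatedDensity V ε u x :=
  Finset.sum_nonneg fun k _ =>
    mul_nonneg ((posPart_nonneg _).trans (IsPotential.posPart_le_add_excess V ε k x)) (sq_nonneg _)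

theorem norm_sq_eq_sum_integral (u : StarL2 ι) :
    ‖u‖ ^ 2 = ∑ i, ∫ x in Ioi (0 : ℝ), ‖u i x‖ ^ 2 := by
  rw [PiLp.norm_sq_eq_of_L2]
  exact Finset.sum_congr rfl fun i _ => norm_sq_eq_integral _

theorem integrable_excess_mul_norm_sq {hV : IsPotential V} {ε : ℝ} (hε : 0 < ε) (p : domain hV)
    (i : ι) :
    Integrable (fun x => IsPotential.excess V ε i x * ‖p.1.1 i x‖ ^ 2) halfLineMeasure := by
  obtain ⟨c, hc⟩ := p.2.1
  exact (hc i).integrable_mul_norm_sq (hV.integrable_excess hε i)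

theorem integrable_truncatedDensity {hV : IsPotential V} {ε : ℝ} (hε : 0 < ε) (p : domain hV) :
    Integrable (truncatedDensity V ε p.1.1) halfLineMeasure := by
  refine integrable_finsetSum _ fun i _ => ?_
  simp only [add_mul]
  exact ((integrable_mul_norm_sq_of_mem_weightedL2 (p.2.2 i)).add
    ((integrable_norm_sq _).const_mul ε)).add (integrable_excess_mul_norm_sq hε p i)

theorem energy_add_excessEnergy {hV : IsPotential V} {ε : ℝ} (hε : 0 < ε) (p : domain hV) :
    energy (sesqForm hV) p + ε * ‖p.1.1‖ ^ 2 + excessEnergy V ε p.1.1 =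
      ‖p.1.2‖ ^ 2 + ∫ x in Ioi (0 : ℝ), truncatedDensity V ε p.1.1 x := by
  have hpot i := integrable_mul_norm_sq_of_mem_weightedL2 (p.2.2 i)
  have hconst i := (integrable_norm_sq (p.1.1 i)).const_mul ε
  have hexc i := integrable_excess_mul_norm_sq hε p i
  have hterm : ∀ i, ∫ x in Ioi (0 : ℝ),
      (V i x + ε + IsPotential.excess V ε i x) * ‖p.1.1 i x‖ ^ 2 =
      (∫ x in Ioi (0 : ℝ), V i x * ‖p.1.1 i x‖ ^ 2) + ε * (∫ x in Ioi (0 : ℝ), ‖p.1.1 i x‖ ^ 2) +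
        ∫ x in Ioi (0 : ℝ), IsPotential.excess V ε i x * ‖p.1.1 i x‖ ^ 2 := by
    intro i
    have hsum : Integrable (fun x => V i x * ‖p.1.1 i x‖ ^ 2 + ε * ‖p.1.1 i x‖ ^ 2)
      halfLineMeasure := (hpot i).add (hconst i)
    simp only [add_mul]
    rw [integral_add hsum (hexc i), integral_add (hpot i) (hconst i),
      integral_const_mul]
  have hsum : ∫ x in Ioi (0 : ℝ), truncatedDensity V ε p.1.1 x =
      ∑ i, ∫ x in Ioi (0 : ℝ), (V i x + ε + IsPotential.excess V ε i x) * ‖p.1.1 i x‖ ^ 2 := by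
    refine integral_finsetSum _ fun i _ => ?_
    simp only [add_mul]
    exact ((hpot i).add (hconst i)).add (hexc i)
  rw [hsum, Finset.sum_congr rfl fun i _ => hterm i, Finset.sum_add_distrib,
    Finset.sum_add_distrib, ← Finset.mul_sum, ← norm_sq_eq_sum_integral, energy_sesqForm,
    excessEnergy]
  ring

theorem norm_deriv_sq_le_energy_add {hV : IsPotential V} {ε : ℝ} (hε : 0 < ε) (p : domain hV) :
    ‖p.1.2‖ ^ 2 ≤ energy (sesqForm hV) p + ε * ‖p.1.1‖ ^ 2 + excessEnergy V ε p.1.1 := by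
  rw [energy_add_excessEnergy hε]
  exact le_add_of_nonneg_right (integral_nonneg (truncatedDensity_nonneg V ε p.1.1))

theorem exists_excessEnergy_le (hV : IsPotential V) {ε : ℝ} (hε : 0 < ε) :
    ∃ C : ℝ, ∀ u u' : StarL2 ι, HasStarDeriv u u' →
      excessEnergy V ε u ≤ 1 / 2 * ‖u'‖ ^ 2 + C * ‖u‖ ^ 2 := by
  set A : ℝ := ∑ i, ∫ x in Ioi (0 : ℝ), IsPotential.excess V ε i x with hA
  have hA0 : 0 ≤ A :=
    Finset.sum_nonneg fun i _ => integral_nonneg (IsPotential.excess_nonneg V ε i)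
  set δ : ℝ := 1 / (4 * (A + 1)) with hδ
  have hδ0 : 0 < δ := by positivity
  refine ⟨A * (2 / δ), fun u u' ⟨c, hc⟩ => ?_⟩
  have hedge : ∀ i, 2 / δ * ‖u i‖ ^ 2 + 2 * δ * ‖u' i‖ ^ 2 ≤
      2 / δ * ‖u‖ ^ 2 + 2 * δ * ‖u'‖ ^ 2 := by
    intro i
    gcongr <;> exact PiLp.norm_apply_le _ i
  calc excessEnergy V ε u
      ≤ ∑ i, (∫ x in Ioi (0 : ℝ), IsPotential.excess V ε i x) *
          (2 / δ * ‖u‖ ^ 2 + 2 * δ * ‖u'‖ ^ 2) :=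
        Finset.sum_le_sum fun i _ => ((hc i).integral_mul_norm_sq_le (hV.integrable_excess hε i)
          (IsPotential.excess_nonneg V ε i) hδ0).trans (mul_le_mul_of_nonneg_left (hedge i)
            (integral_nonneg (IsPotential.excess_nonneg V ε i)))
    _ = A * (2 * δ) * ‖u'‖ ^ 2 + A * (2 / δ) * ‖u‖ ^ 2 := by rw [← Finset.sum_mul, ← hA]; ring
    _ ≤ 1 / 2 * ‖u'‖ ^ 2 + A * (2 / δ) * ‖u‖ ^ 2 := by
        have hδA : A * (2 * δ) ≤ 1 / 2 := by
          rw [hδ]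
          field_simp
          linarith
        gcongr

theorem exists_half_norm_deriv_sq_le (hV : IsPotential V) :
    ∃ C : ℝ, ∀ p : domain hV,
      1 / 2 * ‖p.1.2‖ ^ 2 ≤ energy (sesqForm hV) p + C * ‖p.1.1‖ ^ 2 := by
  obtain ⟨C, hC⟩ := exists_excessEnergy_le hV one_pos
  refine ⟨1 + C, fun p => ?_⟩
  linarith [norm_deriv_sq_le_energy_add one_pos p, hC _ _ p.2.1]

theorem tendsto_excessEnergy (hV : IsPotential V) {ε : ℝ} (hε : 0 < ε) {β : Type*} {l : Filter β}
    [l.IsCountablyGenerated] {u : β → StarL2 ι} {u₀ : StarL2 ι} {M : ℝ}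
    (hM : ∀ i b, ∀ᵐ x ∂halfLineMeasure, ‖u b i x‖ ^ 2 ≤ M)
    (hlim : ∀ i, ∀ᵐ x ∂halfLineMeasure, Tendsto (fun b => u b i x) l (𝓝 (u₀ i x))) :
    Tendsto (fun b => excessEnergy V ε (u b)) l (𝓝 (excessEnergy V ε u₀)) := by
  refine tendsto_finsetSum _ fun i _ => tendsto_integral_filter_of_dominated_convergence
    (fun x => IsPotential.excess V ε i x * M) (.of_forall fun b => ?_) (.of_forall fun b => ?_)
    ((hV.integrable_excess hε i).mul_const M) ?_
  · exact (hV.integrable_excess hε i).aestronglyMeasurable.mul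
      ((aestronglyMeasurable_coe _).norm.pow 2)
  · filter_upwards [hM i b] with x hx
    rw [Real.norm_of_nonneg (mul_nonneg (IsPotential.excess_nonneg V ε i x) (sq_nonneg _))]
    exact mul_le_mul_of_nonneg_left hx (IsPotential.excess_nonneg V ε i x)
  · filter_upwards [hlim i] with x hx
    exact (hx.norm.pow 2).const_mul _

theorem HasStarDeriv.sub {u u' v v' : StarL2 ι} (hu : HasStarDeriv u u')
    (hv : HasStarDeriv v v') : HasStarDeriv (u - v) (u' - v') := by
  obtain ⟨c, hc⟩ := hu
  obtain ⟨d, hd⟩ := hv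
  refine ⟨c + -1 * d, fun i => ?_⟩
  have h := (hc i).add ((hd i).smul (-1))
  rwa [neg_one_smul, neg_one_smul, ← sub_eq_add_neg, ← sub_eq_add_neg] at h

theorem HasStarDeriv.ae_norm_sq_le {u u' : StarL2 ι} (h : HasStarDeriv u u') (i : ι) :
    ∀ᵐ x ∂halfLineMeasure, ‖u i x‖ ^ 2 ≤ 2 * ‖u‖ ^ 2 + 2 * ‖u'‖ ^ 2 := by
  obtain ⟨c, hc⟩ := h
  filter_upwards [(hc i).ae_norm_sq_le one_pos] with x hx
  rw [div_one, mul_one] at hx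
  refine hx.trans ?_
  gcongr <;> exact PiLp.norm_apply_le _ i

section Limits

variable {u u' : ℕ → StarL2 ι} {u₀ u₀' : StarL2 ι}

theorem HasStarDeriv.of_tendsto (h : ∀ n, HasStarDeriv (u n) (u' n))
    (hu : Tendsto u atTop (𝓝 u₀)) (hu' : Tendsto u' atTop (𝓝 u₀')) : HasStarDeriv u₀ u₀' := by
  choose c hc using h
  rcases isEmpty_or_nonempty ι with hι | ⟨⟨i⟩⟩
  · exact ⟨0, hι.elim⟩
  have hui : ∀ i, Tendsto (fun n => u n i) atTop (𝓝 (u₀ i)) := fun i =>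
    ((PiLp.continuous_apply 2 _ i).tendsto u₀).comp hu
  have hui' : ∀ i, Tendsto (fun n => u' n i) atTop (𝓝 (u₀' i)) := fun i =>
    ((PiLp.continuous_apply 2 _ i).tendsto u₀').comp hu'
  obtain ⟨c₀, hc₀⟩ : ∃ c₀, Tendsto c atTop (𝓝 c₀) := by
    refine cauchySeq_tendsto_of_complete (cauchySeq_iff_tendsto_dist_atTop_0.2 ?_)
    have hbound := ((cauchySeq_iff_tendsto_dist_atTop_0.1 (hui i).cauchySeq).pow 2).const_mul 2
      |>.add (((cauchySeq_iff_tendsto_dist_atTop_0.1 (hui' i).cauchySeq).pow 2).const_mul 2)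
    have hsq : Tendsto (fun nm : ℕ × ℕ => dist (c nm.1) (c nm.2) ^ 2) atTop (𝓝 0) := by
      refine squeeze_zero (fun _ => sq_nonneg _) (fun nm => ?_) (by simpa using hbound)
      have h := ((hc nm.1 i).add ((hc nm.2 i).smul (-1))).norm_primitive_sq_le le_rfl one_pos
      rw [primitive_zero_right] at h
      simpa only [neg_one_smul, neg_one_mul, ← sub_eq_add_neg, dist_eq_norm, div_one,
        mul_one] using h
    simpa only [Real.sqrt_sq dist_nonneg, Real.sqrt_zero] using hsq.sqrt
  exact ⟨c₀, fun i => .of_tendsto (fun n => hc n i) (hui i) (hui' i) hc₀⟩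

theorem HasStarDeriv.ae_tendsto (h : ∀ n, HasStarDeriv (u n) (u' n))
    (hu : Tendsto u atTop (𝓝 u₀)) (hu' : Tendsto u' atTop (𝓝 u₀')) (i : ι) :
    ∀ᵐ x ∂halfLineMeasure, Tendsto (fun n => u n i x) atTop (𝓝 (u₀ i x)) := by
  have h₀ : HasStarDeriv u₀ u₀' := .of_tendsto h hu hu'
  have hbound := ((tendsto_iff_norm_sub_tendsto_zero.1 hu).pow 2).const_mul 2
    |>.add (((tendsto_iff_norm_sub_tendsto_zero.1 hu').pow 2).const_mul 2)
  filter_upwards [ae_all_iff.2 fun n => ((h n).sub h₀).ae_norm_sq_le i,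
    ae_all_iff.2 fun n => Lp.coeFn_sub (u n i) (u₀ i)] with x hle hsub
  have hsq : Tendsto (fun n => ‖u n i x - u₀ i x‖ ^ 2) atTop (𝓝 0) := by
    refine squeeze_zero (fun _ => sq_nonneg _) (fun n => ?_) (by simpa using hbound)
    have hx : (u n - u₀) i x = u n i x - u₀ i x := hsub n
    rw [← hx]
    exact hle n
  rw [tendsto_iff_norm_sub_tendsto_zero]
  simpa only [Real.sqrt_sq (norm_nonneg _), Real.sqrt_zero] using hsq.sqrt

end Limits

end Truncation

section Compactness

/-! ### Compactness below the essential spectrum -/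

theorem exists_subseq_forall_tendsto_of_equicontinuous {X E : Type*}
    [TopologicalSpace X] [TopologicalSpace.SeparableSpace X] [MetricSpace E] [ProperSpace E]
    {F : ℕ → X → E} (hF : Equicontinuous F)
    (hbdd : ∀ x, Bornology.IsBounded (range fun n => F n x)) :
    ∃ (φ : ℕ → ℕ) (G : X → E), StrictMono φ ∧
      ∀ x, Tendsto (fun n => F (φ n) x) atTop (𝓝 (G x)) := by
  obtain ⟨s, hs, hdense⟩ := TopologicalSpace.exists_countable_dense X
  have : Countable s := hs.to_subtype
  have hcomp : IsCompact (univ.pi fun x : s => closure (range fun n => F n x)) :=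
    isCompact_univ_pi fun x => (hbdd x).isCompact_closure
  obtain ⟨a, -, φ, hφ, hlim⟩ := hcomp.isSeqCompact (x := fun n (x : s) => F n x)
    fun n x _ => subset_closure (mem_range_self n)
  have hcauchy : ∀ x, CauchySeq fun n => F (φ n) x := by
    intro x
    rw [Metric.cauchySeq_iff]
    intro ε hε
    obtain ⟨U, hU, hclose⟩ := Metric.equicontinuousAt_iff_pair.1 (hF x) (ε / 3) (by positivity)
    obtain ⟨y, hyU, hys⟩ := mem_closure_iff_nhds.1 (hdense x) U hU
    obtain ⟨N, hN⟩ := Metric.cauchySeq_iff.1 (tendsto_pi_nhds.1 hlim ⟨y, hys⟩).cauchySeq (ε / 3)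
      (by positivity)
    refine ⟨N, fun m hm n hn => ?_⟩
    have hxU := mem_of_mem_nhds hU
    have hdist : dist (F (φ m) y) (F (φ n) y) < ε / 3 := hN m hm n hn
    linarith [dist_triangle4 (F (φ m) x) (F (φ m) y) (F (φ n) y) (F (φ n) x),
      hclose x hxU y hyU (φ m), hclose y hyU x hxU (φ n)]
  choose G hG using fun x => cauchySeq_tendsto_of_complete (hcauchy x)
  exact ⟨φ, G, hφ, hG⟩

theorem cauchySeq_of_tendsto_norm_sub_sq {E : Type*} [NormedAddCommGroup E] {x : ℕ → E}
    (h : Tendsto (fun nm : ℕ × ℕ => ‖x nm.1 - x nm.2‖ ^ 2) atTop (𝓝 0)) : CauchySeq x := by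
  rw [cauchySeq_iff_tendsto_dist_atTop_0]
  simpa only [Real.sqrt_sq (norm_nonneg _), Real.sqrt_zero, dist_eq_norm] using h.sqrt

theorem integrable_and_integral_le_of_tendsto {α : Type*} [MeasurableSpace α] {μ : Measure α}
    {f : ℕ → α → ℝ} {g : α → ℝ} {L : ℝ} (hf : ∀ n, Integrable (f n) μ)
    (hf0 : ∀ n, 0 ≤ᵐ[μ] f n) (hlim : ∀ᵐ x ∂μ, Tendsto (fun n => f n x) atTop (𝓝 (g x)))
    (hL : Tendsto (fun n => ∫ x, f n x ∂μ) atTop (𝓝 L)) : Integrable g μ ∧ ∫ x, g x ∂μ ≤ L := by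
  have hg0 : 0 ≤ᵐ[μ] g := by
    filter_upwards [hlim, ae_all_iff.2 hf0] with x hx hx0
    exact ge_of_tendsto' hx hx0
  have hL0 : 0 ≤ L := ge_of_tendsto' hL fun n => integral_nonneg_of_ae (hf0 n)
  have hfatou : ∫⁻ x, ENNReal.ofReal (g x) ∂μ ≤ ENNReal.ofReal L := by
    calc ∫⁻ x, ENNReal.ofReal (g x) ∂μ
        = ∫⁻ x, liminf (fun n => ENNReal.ofReal (f n x)) atTop ∂μ := by
          refine lintegral_congr_ae ?_
          filter_upwards [hlim] with x hx
          exact (ENNReal.tendsto_ofReal hx).liminf_eq.symm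
      _ ≤ liminf (fun n => ∫⁻ x, ENNReal.ofReal (f n x) ∂μ) atTop :=
          lintegral_liminf_le' fun n => (hf n).aestronglyMeasurable.aemeasurable.ennreal_ofReal
      _ = ENNReal.ofReal L := by
          simp only [← ofReal_integral_eq_lintegral_ofReal (hf _) (hf0 _)]
          exact (ENNReal.tendsto_ofReal hL).liminf_eq
  have hInt : Integrable g μ :=
    ⟨aestronglyMeasurable_of_tendsto_ae atTop (fun n => (hf n).aestronglyMeasurable) hlim,
      (hasFiniteIntegral_iff_ofReal hg0).2 (hfatou.trans_lt ENNReal.ofReal_lt_top)⟩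
  rw [← ofReal_integral_eq_lintegral_ofReal hInt hg0] at hfatou
  exact ⟨hInt, (ENNReal.ofReal_le_ofReal_iff hL0).1 hfatou⟩

variable {ι : Type} [Fintype ι] {V : ι → ℝ → ℝ}

theorem exists_subseq_ae_tendsto {u u' : ℕ → StarL2 ι} (h : ∀ n, HasStarDeriv (u n) (u' n))
    {M M' : ℝ} (hu : ∀ n, ‖u n‖ ≤ M) (hu' : ∀ n, ‖u' n‖ ≤ M') :
    ∃ (φ : ℕ → ℕ) (g : ι → ℝ → ℂ), StrictMono φ ∧
      ∀ i, ∀ᵐ x ∂halfLineMeasure, Tendsto (fun n => u (φ n) i x) atTop (𝓝 (g i x)) := by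
  choose c hc using h
  have hui : ∀ n i, ‖u n i‖ ≤ M := fun n i => (PiLp.norm_apply_le _ i).trans (hu n)
  have hui' : ∀ n i, ‖u' n i‖ ≤ M' := fun n i => (PiLp.norm_apply_le _ i).trans (hu' n)
  set F : ℕ → Ici (0 : ℝ) → ι → ℂ := fun n x i => primitive (c n) (u' n i) x
  have hholder : ∀ x y : Ici (0 : ℝ), x ≤ y → ∀ n, dist (F n x) (F n y) ≤ √(dist x y) * M' := by
    intro x y hxy n
    have hM' : 0 ≤ M' := (norm_nonneg _).trans (hu' n)
    refine (dist_pi_le_iff (by positivity)).2 fun i => ?_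
    rw [dist_comm, dist_comm x y, Subtype.dist_eq, Real.dist_eq,
      abs_of_nonneg (sub_nonneg.2 (Subtype.coe_le_coe.2 hxy)), dist_eq_norm]
    exact (norm_primitive_sub_primitive_le _ _ x.2 hxy).trans (by gcongr; exact hui' n i)
  have hequi : Equicontinuous F := by
    refine (Metric.uniformEquicontinuous_of_continuity_modulus (fun r => √r * M') ?_ F
      fun x y n => ?_).equicontinuous
    · simpa using ((Real.continuous_sqrt.mul_const M').tendsto 0)
    · rcases le_total x y with hxy | hxy
      · exact hholder x y hxy n
      · rw [dist_comm, dist_comm x y]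
        exact hholder y x hxy n
  have hbdd : ∀ x, Bornology.IsBounded (range fun n => F n x) := by
    intro x
    refine isBounded_iff_forall_norm_le.2 ⟨√(2 * M ^ 2 + 2 * M' ^ 2), ?_⟩
    rintro _ ⟨n, rfl⟩
    refine (pi_norm_le_iff_of_nonneg (Real.sqrt_nonneg _)).2 fun i => Real.le_sqrt_of_sq_le ?_
    have hle := (hc n i).norm_primitive_sq_le x.2 one_pos
    rw [div_one, mul_one] at hle
    refine hle.trans ?_
    gcongr
    exacts [hui n i, hui' n i]
  obtain ⟨φ, G, hφ, hG⟩ := exists_subseq_forall_tendsto_of_equicontinuous hequi hbdd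
  refine ⟨φ, fun i x => G (projIci 0 x) i, hφ, fun i => ?_⟩
  filter_upwards [ae_all_iff.2 fun n => hc n i, ae_restrict_mem measurableSet_Ioi] with x hx hx0
  have hx0' : x ∈ Ici (0 : ℝ) := mem_Ici.2 (le_of_lt hx0)
  have hlim := tendsto_pi_nhds.1 (hG ⟨x, hx0'⟩) i
  rw [projIci_of_mem hx0']
  exact hlim.congr fun n => (hx (φ n)).symm

theorem exists_subseq_tendsto_excessEnergy_sub (hV : IsPotential V) {ε : ℝ} (hε : 0 < ε)
    {u u' : ℕ → StarL2 ι} (h : ∀ n, HasStarDeriv (u n) (u' n)) {M M' : ℝ}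
    (hu : ∀ n, ‖u n‖ ≤ M) (hu' : ∀ n, ‖u' n‖ ≤ M') :
    ∃ φ : ℕ → ℕ, StrictMono φ ∧ Tendsto
      (fun nm : ℕ × ℕ => excessEnergy V ε (u (φ nm.1) - u (φ nm.2))) atTop (𝓝 0) := by
  obtain ⟨φ, g, hφ, hg⟩ := exists_subseq_ae_tendsto h hu hu'
  have hzero : excessEnergy V ε (0 : StarL2 ι) = 0 := by
    refine Finset.sum_eq_zero fun i _ => integral_eq_zero_of_ae ?_
    filter_upwards [Lp.coeFn_zero ℂ 2 halfLineMeasure] with x hx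
    have hx' : (0 : StarL2 ι) i x = 0 := hx
    simp only [hx', norm_zero, ne_eq, OfNat.ofNat_ne_zero, not_false_eq_true, zero_pow, mul_zero,
      Pi.zero_apply]
  refine ⟨φ, hφ, ?_⟩
  rw [← hzero]
  refine tendsto_excessEnergy hV hε (M := 2 * (2 * M) ^ 2 + 2 * (2 * M') ^ 2)
    (fun i nm => ?_) fun i => ?_
  · filter_upwards [((h (φ nm.1)).sub (h (φ nm.2))).ae_norm_sq_le i] with x hx
    refine hx.trans ?_
    gcongr
    · linarith [norm_sub_le (u (φ nm.1)) (u (φ nm.2)), hu (φ nm.1), hu (φ nm.2)]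
    · linarith [norm_sub_le (u' (φ nm.1)) (u' (φ nm.2)), hu' (φ nm.1), hu' (φ nm.2)]
  · filter_upwards [hg i, Lp.coeFn_zero ℂ 2 halfLineMeasure,
      ae_all_iff.2 fun nm : ℕ × ℕ => Lp.coeFn_sub (u (φ nm.1) i) (u (φ nm.2) i)] with x hx h0 hsub
    have h0' : (0 : StarL2 ι) i x = 0 := h0
    have hsub' : ∀ nm : ℕ × ℕ, (u (φ nm.1) - u (φ nm.2)) i x = u (φ nm.1) i x - u (φ nm.2) i x :=
      hsub
    simp only [h0', hsub']
    have hdist := cauchySeq_iff_tendsto_dist_atTop_0.1 hx.cauchySeq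
    simp only [dist_eq_norm] at hdist
    exact tendsto_zero_iff_norm_tendsto_zero.2 hdist

theorem exists_mem_domain_energy_le (hV : IsPotential V) {p : ℕ → domain hV} {u u' : StarL2 ι}
    {L : ℝ} (hu : Tendsto (fun n => (p n).1.1) atTop (𝓝 u))
    (hu' : Tendsto (fun n => (p n).1.2) atTop (𝓝 u'))
    (hL : Tendsto (fun n => energy (sesqForm hV) (p n)) atTop (𝓝 L)) :
    ∃ q : domain hV, q.1.1 = u ∧ energy (sesqForm hV) q ≤ L := by
  have hderiv : ∀ n, HasStarDeriv (p n).1.1 (p n).1.2 := fun n => (p n).2.1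
  have hae := HasStarDeriv.ae_tendsto hderiv hu hu'
  obtain ⟨M, hM⟩ := hu.norm.bddAbove_range
  obtain ⟨M', hM'⟩ := hu'.norm.bddAbove_range
  have hexcess : Tendsto (fun n => excessEnergy V 1 (p n).1.1) atTop (𝓝 (excessEnergy V 1 u)) := by
    refine tendsto_excessEnergy hV one_pos (M := 2 * M ^ 2 + 2 * M' ^ 2) (fun i n => ?_) hae
    filter_upwards [(hderiv n).ae_norm_sq_le i] with x hx
    refine hx.trans ?_
    gcongr
    exacts [hM (mem_range_self n), hM' (mem_range_self n)]
  have hdensity : Tendsto (fun n => ∫ x in Ioi (0 : ℝ), truncatedDensity V 1 (p n).1.1 x) atTop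
      (𝓝 (L + 1 * ‖u‖ ^ 2 + excessEnergy V 1 u - ‖u'‖ ^ 2)) := by
    refine (((hL.add ((hu.norm.pow 2).const_mul 1)).add hexcess).sub (hu'.norm.pow 2)).congr
      fun n => ?_
    rw [energy_add_excessEnergy one_pos, add_sub_cancel_left]
  obtain ⟨hInt, hle⟩ := integrable_and_integral_le_of_tendsto
    (g := truncatedDensity V 1 u) (fun n => integrable_truncatedDensity one_pos (p n))
    (fun n => .of_forall (truncatedDensity_nonneg V 1 _)) (by
      filter_upwards [ae_all_iff.2 hae] with x hx
      exact tendsto_finsetSum _ fun i _ => ((hx i).norm.pow 2).const_mul _) hdensity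
  have hmem : (u, u') ∈ domain hV := by
    refine mem_domain_of_posPart hV (.of_tendsto hderiv hu hu') fun i => hInt.mono'
      ((hV.aestronglyMeasurable_posPart i).mul ((aestronglyMeasurable_coe _).norm.pow 2))
      (.of_forall fun x => ?_)
    rw [Real.norm_of_nonneg (mul_nonneg (posPart_nonneg _) (sq_nonneg _))]
    exact posPart_mul_norm_sq_le_truncatedDensity V 1 u i x
  refine ⟨⟨(u, u'), hmem⟩, rfl, ?_⟩
  have hid := energy_add_excessEnergy one_pos (⟨(u, u'), hmem⟩ : domain hV)
  simp only at hid
  linarith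

theorem exists_norm_deriv_le (hV : IsPotential V) {p : ℕ → domain hV} {M L : ℝ}
    (hM : ∀ n, ‖(p n).1.1‖ ≤ M)
    (hL : ∀ n, energy (sesqForm hV) (p n) ≤ L) : ∃ M', ∀ n, ‖(p n).1.2‖ ≤ M' := by
  obtain ⟨C, hC⟩ := exists_half_norm_deriv_sq_le hV
  refine ⟨√(2 * (L + |C| * M ^ 2)), fun n => Real.le_sqrt_of_sq_le ?_⟩
  have hmass : C * ‖(p n).1.1‖ ^ 2 ≤ |C| * M ^ 2 :=
    mul_le_mul (le_abs_self C) (pow_le_pow_left₀ (norm_nonneg _) (hM n) 2) (sq_nonneg _)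
      (abs_nonneg C)
  linarith [hC (p n), hL n]

theorem cauchySeq_of_energy_shift_sub_le {hV : IsPotential V} {lam : ℝ} (hlam : lam < 0)
    {p : ℕ → domain hV} {r : ℕ × ℕ → ℝ}
    (hexcess : Tendsto (fun nm : ℕ × ℕ => excessEnergy V (-lam / 2) ((p nm.1).1.1 - (p nm.2).1.1))
      atTop (𝓝 0))
    (hr : Tendsto r atTop (𝓝 0))
    (hle : ∀ nm : ℕ × ℕ,
      energy (shift (sesqForm hV) (embed hV) lam) (p nm.1 - p nm.2) ≤ r nm) :
    CauchySeq (fun n => (p n).1.1) ∧ CauchySeq (fun n => (p n).1.2) := by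
  have hε : 0 < -lam / 2 := by linarith
  have hbound : ∀ nm : ℕ × ℕ, ‖(p nm.1).1.2 - (p nm.2).1.2‖ ^ 2 +
      -lam / 2 * ‖(p nm.1).1.1 - (p nm.2).1.1‖ ^ 2 ≤
        r nm + excessEnergy V (-lam / 2) ((p nm.1).1.1 - (p nm.2).1.1) := by
    intro nm
    have henergy := hle nm
    rw [energy_shift] at henergy
    have hdiff := norm_deriv_sq_le_energy_add hε (p nm.1 - p nm.2)
    change ‖(p nm.1).1.2 - (p nm.2).1.2‖ ^ 2 ≤ _ + -lam / 2 * ‖(p nm.1).1.1 - (p nm.2).1.1‖ ^ 2 +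
      excessEnergy V (-lam / 2) ((p nm.1).1.1 - (p nm.2).1.1) at hdiff
    change _ - lam * ‖(p nm.1).1.1 - (p nm.2).1.1‖ ^ 2 ≤ _ at henergy
    linarith
  have hzero : Tendsto (fun nm : ℕ × ℕ => r nm +
      excessEnergy V (-lam / 2) ((p nm.1).1.1 - (p nm.2).1.1)) atTop (𝓝 0) := by
    simpa only [add_zero] using hr.add hexcess
  constructor
  · refine cauchySeq_of_tendsto_norm_sub_sq (squeeze_zero (fun _ => sq_nonneg _) (fun nm => ?_)
      (by simpa only [mul_zero] using hzero.const_mul (-lam / 2)⁻¹))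
    rw [← inv_mul_le_iff₀ (inv_pos.2 hε), inv_inv]
    linarith [hbound nm, sq_nonneg ‖(p nm.1).1.2 - (p nm.2).1.2‖]
  · refine cauchySeq_of_tendsto_norm_sub_sq (squeeze_zero (fun _ => sq_nonneg _) (fun nm => ?_)
      hzero)
    linarith [hbound nm, mul_nonneg hε.le (sq_nonneg ‖(p nm.1).1.1 - (p nm.2).1.1‖)]

theorem hasDiscreteSpectrumBelow (hV : IsPotential V) {E : ℝ} (hE : E ≤ 0) :
    HasDiscreteSpectrumBelow (sesqForm hV) (embed hV) E where
  isSymm := sesqForm_isSymm hV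
  semibounded := by
    obtain ⟨C, hC⟩ := exists_half_norm_deriv_sq_le hV
    refine ⟨-C, fun p => ?_⟩
    rw [embed_apply]
    linarith [hC p, sq_nonneg ‖p.1.2‖]
  precompact lam hlam x hnorm hlim hpar := by
    have hlam0 : lam < 0 := hlam.trans_le hE
    have henergy : Tendsto (fun n => energy (sesqForm hV) (x n)) atTop (𝓝 lam) := by
      refine ((hlim.add_const lam).congr fun n => ?_).trans (by rw [zero_add])
      rw [energy_shift, hnorm, one_pow, mul_one, sub_add_cancel]
    obtain ⟨L, hL⟩ := henergy.bddAbove_range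
    have hnorm_le : ∀ n, ‖(x n).1.1‖ ≤ 1 := fun n => (hnorm n).le
    obtain ⟨M', hM'⟩ := exists_norm_deriv_le hV hnorm_le fun n => hL (mem_range_self n)
    obtain ⟨φ, hφ, hexcess⟩ := exists_subseq_tendsto_excessEnergy_sub hV
      (show 0 < -lam / 2 by linarith) (fun n => (x n).2.1) hnorm_le hM'
    have hlimφ := hlim.comp hφ.tendsto_atTop
    have hr := (((hlimφ.comp tendsto_fst).add (hlimφ.comp tendsto_snd)).const_mul 2)
    rw [prod_atTop_atTop_eq, add_zero, mul_zero] at hr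
    obtain ⟨hcauchy, hcauchy'⟩ := cauchySeq_of_energy_shift_sub_le (p := fun n => x (φ n)) hlam0
      hexcess hr fun nm => hpar _ _
    obtain ⟨u, hu⟩ := cauchySeq_tendsto_of_complete hcauchy
    obtain ⟨u', hu'⟩ := cauchySeq_tendsto_of_complete hcauchy'
    obtain ⟨q, rfl, hq⟩ := exists_mem_domain_energy_le hV hu hu' (henergy.comp hφ.tendsto_atTop)
    have hnorm_q : ‖embed hV q‖ = 1 :=
      tendsto_nhds_unique hu.norm (tendsto_const_nhds.congr fun n => (hnorm (φ n)).symm)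
    refine ⟨q, φ, hu, ?_⟩
    rw [energy_shift, hnorm_q]
    linarith

end Compactness

section LayerCake

/-! ### Traces as integrals of counting functions -/

theorem tsum_lintegral_le_lintegral_tsum {α κ : Type*} [MeasurableSpace α] {μ : Measure α}
    {f : κ → α → ℝ≥0∞} (hf : ∀ i, Measurable (f i)) :
    ∑' i, ∫⁻ a, f i a ∂μ ≤ ∫⁻ a, ∑' i, f i a ∂μ := by
  rw [ENNReal.tsum_eq_iSup_sum]
  refine iSup_le fun s => ?_
  rw [← lintegral_finsetSum s fun i _ => hf i]
  exact lintegral_mono fun a => ENNReal.sum_le_tsum s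

theorem lintegral_tsum_of_eq_zero_of_lintegral_eq_zero {α κ : Type*} [MeasurableSpace α]
    {μ : Measure α} {f : κ → α → ℝ≥0∞} (hf : ∀ i, Measurable (f i))
    (hzero : ∀ i, ∫⁻ a, f i a ∂μ = 0 → f i = 0) :
    ∫⁻ a, ∑' i, f i a ∂μ = ∑' i, ∫⁻ a, f i a ∂μ := by
  refine le_antisymm ?_ (tsum_lintegral_le_lintegral_tsum hf)
  by_cases htop : ∑' i, ∫⁻ a, f i a ∂μ = ∞
  · exact htop ▸ le_top
  set T := Function.support fun i => ∫⁻ a, f i a ∂μ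
  have : Countable T := (Summable.countable_support_ennreal htop).to_subtype
  have hsub : ∀ a, ∑' i, f i a = ∑' i : T, f i a := fun a =>
    (tsum_subtype_eq_of_support_subset (f := fun i => f i a) fun i hi hInt =>
      hi (congrFun (hzero i hInt) a)).symm
  simp only [hsub]
  rw [lintegral_tsum fun i : T => (hf i).aemeasurable]
  exact ENNReal.tsum_comp_le_tsum_of_injective Subtype.val_injective _

theorem lintegral_indicator_Iio_neg_rpow {γ : ℝ} (hγ : 0 < γ) {lam : ℝ} (hlam : lam < 0)
    (m : ℝ → ℝ≥0∞) :
    ∫⁻ s in Ioi (0 : ℝ), (Iio (-s ^ (1 / γ))).indicator m lam =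
      m lam * ENNReal.ofReal (|lam| ^ γ) := by
  have hiff : ∀ s ∈ Ioi (0 : ℝ), (Iio (-s ^ (1 / γ))).indicator m lam =
      (Iio (|lam| ^ γ)).indicator (fun _ => m lam) s := by
    intro s hs
    have hlt : lam ∈ Iio (-s ^ (1 / γ)) ↔ s ∈ Iio (|lam| ^ γ) := by
      rw [mem_Iio, mem_Iio, lt_neg, ← abs_of_neg hlam, one_div]
      exact Real.rpow_inv_lt_iff_of_pos (le_of_lt hs) (abs_nonneg lam) hγ
    classical
    simp only [indicator_apply, hlt]
  rw [setLIntegral_congr_fun measurableSet_Ioi hiff, lintegral_indicator_const measurableSet_Iio,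
    Measure.restrict_apply measurableSet_Iio, inter_comm, Ioi_inter_Iio, Real.volume_Ioo, sub_zero]

theorem tsum_mul_ofReal_abs_rpow {γ : ℝ} (hγ : 0 < γ) (m : ℝ → ℝ≥0∞) :
    ∑' lam : Iio (0 : ℝ), m lam * ENNReal.ofReal (|(lam : ℝ)| ^ γ) =
      ∫⁻ s in Ioi (0 : ℝ), ∑' lam : Iio (-s ^ (1 / γ)), m lam := by
  have hsum : ∀ s ∈ Ioi (0 : ℝ), ∑' lam : Iio (-s ^ (1 / γ)), m lam =
      ∑' lam : Iio (0 : ℝ), (Iio (-s ^ (1 / γ))).indicator m lam := by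
    intro s hs
    have hle : -s ^ (1 / γ) ≤ 0 := neg_nonpos.2 (Real.rpow_nonneg (le_of_lt hs) _)
    rw [tsum_subtype, tsum_subtype (Iio (0 : ℝ)) ((Iio (-s ^ (1 / γ))).indicator m),
      indicator_indicator, inter_eq_right.2 (Iio_subset_Iio hle)]
  have hmeas : ∀ lam : Iio (0 : ℝ),
      Measurable fun s : ℝ => (Iio (-s ^ (1 / γ))).indicator m (lam : ℝ) := by
    classical
    intro lam
    simp only [indicator_apply, mem_Iio]
    exact .ite (measurableSet_lt measurable_const (by fun_prop)) measurable_const measurable_const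
  rw [setLIntegral_congr_fun measurableSet_Ioi hsum,
    lintegral_tsum_of_eq_zero_of_lintegral_eq_zero hmeas fun lam hlam => ?_]
  · exact tsum_congr fun lam => (lintegral_indicator_Iio_neg_rpow hγ lam.2 m).symm
  · have hlam0 : 0 < |(lam : ℝ)| := abs_pos.2 (ne_of_lt lam.2)
    rw [lintegral_indicator_Iio_neg_rpow hγ lam.2, mul_eq_zero, ENNReal.ofReal_eq_zero] at hlam
    have hm : m lam = 0 := hlam.resolve_right (not_le.2 (Real.rpow_pos_of_pos hlam0 _))
    exact funext fun s => indicator_apply_eq_zero.2 fun _ => hm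

variable {ι : Type} [Fintype ι] {V : ι → ℝ → ℝ}

theorem traceNeg_eq_lintegral_count (hV : IsPotential V) {γ : ℝ} (hγ : 0 < γ) :
    traceNeg γ V = ∫⁻ s in Ioi (0 : ℝ), (count hV (-s ^ (1 / γ)) : ℝ≥0∞) := by
  simp only [toENNReal_count]
  exact tsum_mul_ofReal_abs_rpow hγ fun lam => multiplicity V lam

theorem measurable_count_neg_rpow (hV : IsPotential V) (γ : ℝ) :
    Measurable fun s : ℝ => (count hV (-s ^ (1 / γ)) : ℝ≥0∞) :=
  Monotone.measurable (fun _ _ h => ENat.toENNReal_le.2 (formCount_mono _ _ h)) |>.comp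
    (f := fun s : ℝ => -s ^ (1 / γ)) (by fun_prop)

end LayerCake

section Decoupling

/-! ### Decoupling the edges -/

theorem IsPotential.comp {ι κ : Type} {V : ι → ℝ → ℝ} (hV : IsPotential V) (e : κ → ι) :
    IsPotential (V ∘ e) where
  posPart_loc i := hV.posPart_loc (e i)
  negPart_memLp := by
    obtain ⟨p, hp1, hp, hLp⟩ := hV.negPart_memLp
    exact ⟨p, hp1, hp, fun i => hLp (e i)⟩

theorem negIntegral_comp_ne_top {ι κ : Type} [Fintype ι] [Fintype κ] {γ : ℝ} {V : ι → ℝ → ℝ}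
    (h : negIntegral γ V ≠ ∞) (e : κ → ι) : negIntegral γ (V ∘ e) ≠ ∞ := by
  rw [negIntegral, ENNReal.sum_ne_top] at h ⊢
  exact fun i _ => h (e i) (Finset.mem_univ _)

variable {ι : Type} [Fintype ι] {V : ι → ℝ → ℝ}

/-- The density `|u'|² + (w - E) |u|²` of the quadratic form of `H - E` on an edge with
potential `w`. -/
def edgeDensity (w : ℝ → ℝ) (E : ℝ) (u u' : ℝ → ℂ) (x : ℝ) : ℝ :=
  ‖u' x‖ ^ 2 + (w x - E) * ‖u x‖ ^ 2

theorem edgeDensity_eq_add_sub (w : ℝ → ℝ) (E : ℝ) (u u' : ℝ → ℂ) : edgeDensity w E u u' =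
    fun x => ‖u' x‖ ^ 2 + w x * ‖u x‖ ^ 2 - E * ‖u x‖ ^ 2 := by
  ext x
  rw [edgeDensity]
  ring

theorem integrable_edgeDensity {w : ℝ → ℝ} {u : HalfLineL2}
    (hu : Integrable (fun x => w x * ‖u x‖ ^ 2) halfLineMeasure) (E : ℝ) (u' : HalfLineL2) :
    Integrable (edgeDensity w E u u') halfLineMeasure := by
  rw [edgeDensity_eq_add_sub]
  exact ((integrable_norm_sq u').add hu).sub ((integrable_norm_sq u).const_mul E)

theorem energy_shift_sesqForm {hV : IsPotential V} (E : ℝ) (p : domain hV) :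
    energy (shift (sesqForm hV) (embed hV) E) p =
      ∑ i, ∫ x, edgeDensity (V i) E (p.1.1 i) (p.1.2 i) x ∂halfLineMeasure := by
  have hedge : ∀ i, ∫ x, edgeDensity (V i) E (p.1.1 i) (p.1.2 i) x ∂halfLineMeasure =
      ‖p.1.2 i‖ ^ 2 + (∫ x in Ioi (0 : ℝ), V i x * ‖p.1.1 i x‖ ^ 2) - E * ‖p.1.1 i‖ ^ 2 := by
    intro i
    have hderiv := integrable_norm_sq (p.1.2 i)
    have hpot := integrable_mul_norm_sq_of_mem_weightedL2 (p.2.2 i)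
    rw [norm_sq_eq_integral, norm_sq_eq_integral, ← integral_add hderiv hpot,
      ← integral_const_mul, edgeDensity_eq_add_sub]
    exact integral_sub (hderiv.add hpot) ((integrable_norm_sq _).const_mul E)
  rw [energy_shift, energy_sesqForm, embed_apply, PiLp.norm_sq_eq_of_L2, PiLp.norm_sq_eq_of_L2]
  simp only [hedge, Finset.sum_sub_distrib, Finset.sum_add_distrib, Finset.mul_sum]

/-- Restriction of functions in the form domain to some of the edges. -/
def restrictEdges {κ : Type} [Fintype κ] (hV : IsPotential V) (e : κ → ι) :
    domain hV →ₗ[ℂ] domain (hV.comp e) where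
  toFun p := ⟨(WithLp.toLp 2 fun i => p.1.1 (e i), WithLp.toLp 2 fun i => p.1.2 (e i)), by
    obtain ⟨⟨c, hc⟩, hp⟩ := p.2
    exact ⟨⟨c, fun i => hc (e i)⟩, fun i => hp (e i)⟩⟩
  map_add' _ _ := rfl
  map_smul' _ _ := rfl

theorem count_le_sum_count {C : Type*} [Fintype C] {κ : C → Type} [∀ c, Fintype (κ c)]
    (hV : IsPotential V) (e : (Σ c, κ c) ≃ ι) {E : ℝ} (hE : E ≤ 0) :
    count hV E ≤ ∑ c, count (hV.comp fun i : κ c => e ⟨c, i⟩) E := by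
  refine ENat.forall_natCast_le_iff_le.1 fun k hk => ?_
  obtain ⟨f, hf⟩ := (hasDiscreteSpectrumBelow hV hE).natCast_le_formCount_iff.1 hk
  refine natCast_le_sum_formCount (fun c => hasDiscreteSpectrumBelow (hV.comp _) hE)
    (fun c i => restrictEdges hV _ (f i)) fun a ha => ?_
  simp only [← map_smul, ← map_sum]
  refine lt_of_eq_of_lt ?_ (hf a ha)
  rw [energy_shift_sesqForm, ← e.sum_comp, Fintype.sum_sigma]
  exact Finset.sum_congr rfl fun c _ => energy_shift_sesqForm E _

theorem traceNeg_le_sum_traceNeg {C : Type*} [Fintype C] {κ : C → Type} [∀ c, Fintype (κ c)]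
    (hV : IsPotential V) (e : (Σ c, κ c) ≃ ι) {γ : ℝ} (hγ : 0 < γ) :
    traceNeg γ V ≤ ∑ c, traceNeg γ (V ∘ fun i : κ c => e ⟨c, i⟩) := by
  simp only [traceNeg_eq_lintegral_count hV hγ, traceNeg_eq_lintegral_count (hV.comp _) hγ]
  rw [← lintegral_finsetSum _ fun c _ => measurable_count_neg_rpow _ γ]
  refine setLIntegral_mono' measurableSet_Ioi fun s hs => ?_
  have hle := ENat.toENNReal_le.2 (count_le_sum_count hV e
    (neg_nonpos.2 (Real.rpow_nonneg (le_of_lt hs) (1 / γ))))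
  rwa [← ENat.toENNRealRingHom_apply, map_sum] at hle

theorem count_eq_zero_of_nonneg (hV : IsPotential V)
    (hnonneg : ∀ i, ∀ᵐ x ∂halfLineMeasure, 0 ≤ V i x) {E : ℝ} (hE : E ≤ 0) : count hV E = 0 := by
  by_contra hne
  have hone : ((1 : ℕ) : ℕ∞) ≤ count hV E := by
    rwa [Nat.cast_one, Order.one_le_iff_ne_zero]
  obtain ⟨f, hf⟩ := (hasDiscreteSpectrumBelow hV hE).natCast_le_formCount_iff.1 hone
  have hneg := hf (fun _ => 1) fun h => one_ne_zero (congrFun h 0)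
  rw [energy_shift_sesqForm] at hneg
  refine hneg.not_ge (Finset.sum_nonneg fun i _ => integral_nonneg_of_ae ?_)
  filter_upwards [hnonneg i] with x hx
  exact add_nonneg (sq_nonneg _) (mul_nonneg (sub_nonneg.2 (hE.trans hx)) (sq_nonneg _))

theorem traceNeg_eq_zero (hV : IsPotential V) {γ : ℝ} (hγ : 0 < γ) (h : negIntegral γ V = 0) :
    traceNeg γ V = 0 := by
  have hnonneg : ∀ i, ∀ᵐ x ∂halfLineMeasure, 0 ≤ V i x := by
    intro i
    obtain ⟨p, -, -, hLp⟩ := hV.negPart_memLp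
    rw [negIntegral, Finset.sum_eq_zero_iff] at h
    have hi := h i (Finset.mem_univ i)
    rw [lintegral_eq_zero_iff'
      ((hLp i).aestronglyMeasurable.aemeasurable.pow_const _).ennreal_ofReal] at hi
    filter_upwards [hi] with x hx
    rw [Pi.zero_apply, ENNReal.ofReal_eq_zero] at hx
    by_contra! hneg
    exact hx.not_gt (Real.rpow_pos_of_pos (negPart_pos_iff.2 hneg) _)
  rw [traceNeg_eq_lintegral_count hV hγ, setLIntegral_congr_fun measurableSet_Ioi fun s hs => by
    rw [count_eq_zero_of_nonneg hV hnonneg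
      (neg_nonpos.2 (Real.rpow_nonneg (le_of_lt hs) _)), ENat.toENNReal_zero], lintegral_zero]

end Decoupling

section OptimalConstants

/-! ### Optimal constants -/

theorem traceNeg_le_optConst_mul {γ : ℝ} (hγ : 0 < γ) {N : ℕ} {V : Fin N → ℝ → ℝ}
    (hV : IsPotential V) (hI : negIntegral γ V ≠ ∞) :
    traceNeg γ V ≤ optConst γ N * negIntegral γ V := by
  rcases eq_or_ne (negIntegral γ V) 0 with h0 | h0
  · exact (traceNeg_eq_zero hV hγ h0).trans_le zero_le
  · rw [← ENNReal.div_le_iff h0 hI]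
    exact le_sInf fun L hL => (ENNReal.div_le_iff h0 hI).2 (hL V hV hI)

theorem traceNeg_le_sum_optConst_mul {γ : ℝ} (hγ : 0 < γ) {C : Type*} [Fintype C] {n : C → ℕ}
    {N : ℕ} (e : (Σ c, Fin (n c)) ≃ Fin N) {V : Fin N → ℝ → ℝ} (hV : IsPotential V)
    (hI : negIntegral γ V ≠ ∞) :
    traceNeg γ V ≤ ∑ c, optConst γ (n c) * negIntegral γ (V ∘ fun i => e ⟨c, i⟩) :=
  (traceNeg_le_sum_traceNeg hV e hγ).trans (Finset.sum_le_sum fun _ _ =>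
    traceNeg_le_optConst_mul hγ (hV.comp _) (negIntegral_comp_ne_top hI _))

theorem sum_negIntegral_comp_add {M N : ℕ} [NeZero N] (γ : ℝ) (V : Fin N → ℝ → ℝ)
    (j : Fin M → Fin N) :
    ∑ k : Fin N, negIntegral γ (V ∘ fun i => j i + k) = M * negIntegral γ V := by
  simp only [negIntegral, Function.comp_def]
  rw [Finset.sum_comm]
  have hshift : ∀ i : Fin M, ∑ k : Fin N, ∫⁻ x in Ioi (0 : ℝ),
      ENNReal.ofReal ((V (j i + k) x)⁻ ^ (γ + 1 / 2)) =
      ∑ k : Fin N, ∫⁻ x in Ioi (0 : ℝ), ENNReal.ofReal ((V k x)⁻ ^ (γ + 1 / 2)) := fun i =>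
    Equiv.sum_comp (Equiv.addLeft (j i)) fun k => ∫⁻ x in Ioi (0 : ℝ),
      ENNReal.ofReal ((V k x)⁻ ^ (γ + 1 / 2))
  simp only [hshift, Finset.sum_const, Finset.card_univ, Fintype.card_fin, nsmul_eq_mul]

-- The edges are grouped in `N` ways, one for each rotation; averaging makes every edge contribute
-- equally to every group.
theorem optConst_le_sum_div_mul {γ : ℝ} (hγ : 0 < γ) {C : Type*} [Fintype C] {n : C → ℕ} {N : ℕ}
    (e : (Σ c, Fin (n c)) ≃ Fin N) :
    optConst γ N ≤ ∑ c, (n c / N : ℝ≥0∞) * optConst γ (n c) := by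
  refine sInf_le fun V hV hI => ?_
  rcases Nat.eq_zero_or_pos N with rfl | hN
  · exact (traceNeg_eq_zero hV hγ Finset.sum_empty).trans_le zero_le
  have : NeZero N := ⟨hN.ne'⟩
  have hN0 : (N : ℝ≥0∞) ≠ 0 := Nat.cast_ne_zero.2 hN.ne'
  have hrot : ∀ k : Fin N, traceNeg γ V ≤
      ∑ c, optConst γ (n c) * negIntegral γ (V ∘ fun i => e ⟨c, i⟩ + k) := fun k =>
    traceNeg_le_sum_optConst_mul hγ (e.trans (Equiv.addRight k)) hV hI
  rw [← ENNReal.mul_le_mul_iff_right hN0 (ENNReal.natCast_ne_top N)]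
  calc (N : ℝ≥0∞) * traceNeg γ V = ∑ _k : Fin N, traceNeg γ V := by
        rw [Finset.sum_const, Finset.card_univ, Fintype.card_fin, nsmul_eq_mul]
    _ ≤ ∑ k : Fin N, ∑ c, optConst γ (n c) * negIntegral γ (V ∘ fun i => e ⟨c, i⟩ + k) :=
        Finset.sum_le_sum fun k _ => hrot k
    _ = ∑ c, optConst γ (n c) * (n c * negIntegral γ V) := by
        rw [Finset.sum_comm]
        simp only [← Finset.mul_sum, sum_negIntegral_comp_add]
    _ = N * ((∑ c, (n c / N : ℝ≥0∞) * optConst γ (n c)) * negIntegral γ V) := by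
        rw [Finset.sum_mul, Finset.mul_sum]
        refine Finset.sum_congr rfl fun c _ => ?_
        rw [← mul_assoc (N : ℝ≥0∞), ← mul_assoc (N : ℝ≥0∞),
          ENNReal.mul_div_cancel hN0 (ENNReal.natCast_ne_top N)]
        ring

theorem optConst_mul_le {γ : ℝ} (hγ : 0 < γ) (m N : ℕ) : optConst γ (m * N) ≤ optConst γ N := by
  refine (optConst_le_sum_div_mul hγ
    ((Equiv.sigmaEquivProd (Fin m) (Fin N)).trans finProdFinEquiv)).trans ?_
  rw [Finset.sum_const, Finset.card_univ, Fintype.card_fin, nsmul_eq_mul, ← mul_assoc,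
    ← mul_div_assoc, Nat.cast_mul]
  exact mul_le_of_le_one_left' ENNReal.div_self_le_one

theorem optConst_add_le {γ : ℝ} (hγ : 0 < γ) (M K : ℕ) :
    optConst γ (M + K) ≤ (M / (M + K : ℕ) : ℝ≥0∞) * optConst γ M +
      (K / (M + K : ℕ) : ℝ≥0∞) * optConst γ K := by
  have hle := optConst_le_sum_div_mul hγ
    (finSigmaFinEquiv (n := ![M, K]) |>.trans (finCongr (Fin.sum_univ_two _)))
  rwa [Fin.sum_univ_two] at hle

end OptimalConstants

section Gluing

/-! ### Moving the vertex of the line -/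

/-- The function on the half-line obtained from a function on the line, given by its restrictions
`f` and `g` to the two edges, by moving the origin to the point `R` of the second edge and keeping
the half-line on the side of the first edge. -/
def glue {α : Type*} (R : ℝ) (f g : ℝ → α) : ℝ → α :=
  (Iic R).piecewise (fun x => g (R - x)) fun x => f (x - R)

theorem glue_of_le {α : Type*} {R : ℝ} (f g : ℝ → α) {x : ℝ} (h : x ≤ R) :
    glue R f g x = g (R - x) := piecewise_eq_of_mem _ _ _ h

theorem glue_of_lt {α : Type*} {R : ℝ} (f g : ℝ → α) {x : ℝ} (h : R < x) :
    glue R f g x = f (x - R) := piecewise_eq_of_notMem _ _ _ (not_le.2 h)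

theorem map_glue {α β : Type*} (φ : α → β) (R : ℝ) (f g : ℝ → α) (x : ℝ) :
    φ (glue R f g x) = glue R (fun t => φ (f t)) (fun t => φ (g t)) x := by
  rcases le_or_gt x R with h | h
  · simp only [glue_of_le _ _ h]
  · simp only [glue_of_lt _ _ h]

theorem glue_add {α : Type*} [Add α] (R : ℝ) (f f' g g' : ℝ → α) :
    glue R (f + f') (g + g') = glue R f g + glue R f' g' := by
  ext x
  rcases le_or_gt x R with h | h
  · simp only [Pi.add_apply, glue_of_le _ _ h]
  · simp only [Pi.add_apply, glue_of_lt _ _ h]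

variable {R : ℝ} {E : Type*} [NormedAddCommGroup E]

theorem halfLineMeasure_restrict_Iic (R : ℝ) :
    halfLineMeasure.restrict (Iic R) = volume.restrict (Ioc 0 R) := by
  rw [Measure.restrict_restrict measurableSet_Iic, inter_comm, Ioi_inter_Iic]

theorem halfLineMeasure_restrict_Ioi (hR : 0 ≤ R) :
    halfLineMeasure.restrict (Ioi R) = volume.restrict (Ioi R) := by
  rw [Measure.restrict_restrict measurableSet_Ioi, inter_eq_left.2 (Ioi_subset_Ioi hR)]

theorem measurePreserving_reflect (R : ℝ) : MeasurePreserving (fun x : ℝ => R - x)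
    (halfLineMeasure.restrict (Iic R)) (halfLineMeasure.restrict (Iic R)) := by
  have h := (Measure.measurePreserving_sub_left (volume : Measure ℝ) R).restrict_preimage
    (measurableSet_Ioc (a := 0) (b := R))
  rwa [preimage_const_sub_Ioc, sub_self, sub_zero, restrict_Ico_eq_restrict_Ioc,
    ← halfLineMeasure_restrict_Iic] at h

theorem measurePreserving_translate_sub (hR : 0 ≤ R) : MeasurePreserving (fun x : ℝ => x - R)
    (halfLineMeasure.restrict (Ioi R)) halfLineMeasure := by
  have h := (measurePreserving_sub_right (volume : Measure ℝ) R).restrict_preimage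
    (measurableSet_Ioi (a := 0))
  rwa [preimage_sub_const_Ioi, zero_add, ← halfLineMeasure_restrict_Ioi hR] at h

theorem measurePreserving_translate_add (hR : 0 ≤ R) : MeasurePreserving (fun x : ℝ => R + x)
    halfLineMeasure (halfLineMeasure.restrict (Ioi R)) := by
  have h := (measurePreserving_add_left (volume : Measure ℝ) R).restrict_preimage
    (measurableSet_Ioi (a := R))
  rwa [preimage_const_add_Ioi, sub_self, ← halfLineMeasure_restrict_Ioi hR] at h

theorem ae_glue (hR : 0 ≤ R) {p q : ℝ → Prop} (hp : ∀ᵐ x ∂halfLineMeasure, p x)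
    (hq : ∀ᵐ x ∂halfLineMeasure, q x) : ∀ᵐ x ∂halfLineMeasure, glue R p q x := by
  refine ae_of_ae_restrict_of_ae_restrict_compl (Iic R) ?_ ?_
  · filter_upwards [(measurePreserving_reflect R).quasiMeasurePreserving.ae
      (ae_mono Measure.restrict_le_self hq), ae_restrict_mem measurableSet_Iic] with x hx hmem
    rwa [glue_of_le _ _ hmem]
  · rw [compl_Iic]
    filter_upwards [(measurePreserving_translate_sub hR).quasiMeasurePreserving.ae hp,
      ae_restrict_mem measurableSet_Ioi] with x hx hmem
    rwa [glue_of_lt _ _ hmem]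

theorem glue_congr_ae {α : Type*} (hR : 0 ≤ R) {f f' g g' : ℝ → α} (hf : f =ᵐ[halfLineMeasure] f')
    (hg : g =ᵐ[halfLineMeasure] g') : glue R f g =ᵐ[halfLineMeasure] glue R f' g' := by
  filter_upwards [ae_glue hR hf hg] with x hx
  rcases le_or_gt x R with h | h
  · rw [glue_of_le _ _ h] at hx
    rwa [glue_of_le _ _ h, glue_of_le _ _ h]
  · rw [glue_of_lt _ _ h] at hx
    rwa [glue_of_lt _ _ h, glue_of_lt _ _ h]

theorem ae_translate (hR : 0 ≤ R) {q : ℝ → Prop} (hq : ∀ᵐ x ∂halfLineMeasure, q x) :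
    ∀ᵐ x ∂halfLineMeasure, q (R + x) :=
  (measurePreserving_translate_add hR).quasiMeasurePreserving.ae
    (ae_mono Measure.restrict_le_self hq)

theorem memLp_glue {p : ℝ≥0∞} (hR : 0 ≤ R) {f g : ℝ → E} (hf : MemLp f p halfLineMeasure)
    (hg : MemLp g p halfLineMeasure) : MemLp (glue R f g) p halfLineMeasure := by
  refine MemLp.piecewise measurableSet_Iic
    ((hg.mono_measure Measure.restrict_le_self).comp_measurePreserving
      (measurePreserving_reflect R)) ?_
  rw [compl_Iic]
  exact hf.comp_measurePreserving (measurePreserving_translate_sub hR)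

theorem memLp_translate {p : ℝ≥0∞} (hR : 0 ≤ R) {g : ℝ → E} (hg : MemLp g p halfLineMeasure) :
    MemLp (fun x => g (R + x)) p halfLineMeasure :=
  (hg.mono_measure Measure.restrict_le_self).comp_measurePreserving
    (measurePreserving_translate_add hR)

theorem integrable_glue (hR : 0 ≤ R) {f g : ℝ → E} (hf : Integrable f halfLineMeasure)
    (hg : Integrable g halfLineMeasure) : Integrable (glue R f g) halfLineMeasure :=
  memLp_one_iff_integrable.1
    (memLp_glue hR (memLp_one_iff_integrable.2 hf) (memLp_one_iff_integrable.2 hg))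

theorem integrable_translate (hR : 0 ≤ R) {g : ℝ → E} (hg : Integrable g halfLineMeasure) :
    Integrable (fun x => g (R + x)) halfLineMeasure :=
  memLp_one_iff_integrable.1 (memLp_translate hR (memLp_one_iff_integrable.2 hg))

theorem integral_translate [NormedSpace ℝ E] (hR : 0 ≤ R) (g : ℝ → E) :
    ∫ x, g (R + x) ∂halfLineMeasure = ∫ x in Ioi R, g x ∂halfLineMeasure :=
  (measurePreserving_translate_add hR).integral_comp (measurableEmbedding_addLeft R) g

theorem lintegral_translate (hR : 0 ≤ R) (g : ℝ → ℝ≥0∞) :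
    ∫⁻ x, g (R + x) ∂halfLineMeasure = ∫⁻ x in Ioi R, g x ∂halfLineMeasure :=
  (measurePreserving_translate_add hR).lintegral_comp_emb (measurableEmbedding_addLeft R) g

theorem integral_glue_add_integral_Ioi [NormedSpace ℝ E] (hR : 0 ≤ R) {f g : ℝ → E}
    (hf : Integrable f halfLineMeasure) (hg : Integrable g halfLineMeasure) :
    ∫ x, glue R f g x ∂halfLineMeasure + ∫ x in Ioi R, g x ∂halfLineMeasure =
      ∫ x, f x ∂halfLineMeasure + ∫ x, g x ∂halfLineMeasure := by
  have hInt := integrable_glue hR hf hg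
  have hleft : ∫ x in Iic R, glue R f g x ∂halfLineMeasure = ∫ x in Iic R, g x ∂halfLineMeasure :=
    (setIntegral_congr_fun measurableSet_Iic fun x hx => glue_of_le f g hx).trans
      ((measurePreserving_reflect R).integral_comp (Homeomorph.subLeft R).measurableEmbedding g)
  have hright : ∫ x in (Iic R)ᶜ, glue R f g x ∂halfLineMeasure = ∫ x, f x ∂halfLineMeasure := by
    rw [compl_Iic]
    exact (setIntegral_congr_fun measurableSet_Ioi fun x hx => glue_of_lt f g hx).trans
      ((measurePreserving_translate_sub hR).integral_comp
        (Homeomorph.subRight R).measurableEmbedding f)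
  rw [← integral_add_compl measurableSet_Iic hInt, ← integral_add_compl measurableSet_Iic hg, hleft,
    hright, compl_Iic, add_right_comm, add_comm]

theorem lintegral_glue_le (hR : 0 ≤ R) (f g : ℝ → ℝ≥0∞) :
    ∫⁻ x, glue R f g x ∂halfLineMeasure ≤
      ∫⁻ x, f x ∂halfLineMeasure + ∫⁻ x, g x ∂halfLineMeasure := by
  rw [glue, lintegral_piecewise measurableSet_Iic, compl_Iic,
    (measurePreserving_reflect R).lintegral_comp_emb
      (Homeomorph.subLeft R).measurableEmbedding,
    (measurePreserving_translate_sub hR).lintegral_comp_emb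
      (Homeomorph.subRight R).measurableEmbedding, add_comm]
  exact add_le_add_right (setLIntegral_le_lintegral _ _) _

theorem intervalIntegrable_glue (hR : 0 ≤ R) {S : ℝ} (hS : 0 ≤ S) {f g : ℝ → E}
    (hf : IntervalIntegrable f volume 0 S) (hg : IntervalIntegrable g volume 0 R) :
    IntervalIntegrable (glue R f g) volume 0 (R + S) := by
  have hleft : IntervalIntegrable (glue R f g) volume 0 R := by
    have hreflect := (hg.comp_sub_left R).symm
    rw [sub_self, sub_zero] at hreflect
    refine hreflect.congr fun x hx => ?_
    rw [uIoc_of_le hR] at hx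
    exact (glue_of_le f g hx.2).symm
  have hright : IntervalIntegrable (glue R f g) volume R (R + S) := by
    have htranslate := hf.comp_sub_right R
    rw [zero_add, add_comm S] at htranslate
    refine htranslate.congr fun x hx => ?_
    rw [uIoc_of_le (le_add_of_nonneg_right hS)] at hx
    exact (glue_of_lt f g hx.1).symm
  exact hleft.trans hright

end Gluing

section Grafting

/-! ### Transplantation from the line to a star graph -/

variable {R : ℝ}

/-- `glue` for `L²` functions. -/
def glueL2 (hR : 0 ≤ R) : HalfLineL2 × HalfLineL2 →ₗ[ℂ] HalfLineL2 where
  toFun p := (memLp_glue hR (Lp.memLp p.1) (Lp.memLp p.2)).toLp _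
  map_add' p q := by
    rw [← MemLp.toLp_add]
    exact MemLp.toLp_congr _ _ ((glue_congr_ae hR (Lp.coeFn_add p.1 q.1)
      (Lp.coeFn_add p.2 q.2)).trans (.of_eq (glue_add R _ _ _ _)))
  map_smul' k p := by
    rw [RingHom.id_apply, ← MemLp.toLp_const_smul]
    exact MemLp.toLp_congr _ _ ((glue_congr_ae hR (Lp.coeFn_smul k p.1)
      (Lp.coeFn_smul k p.2)).trans
        (.of_eq (funext fun x => (map_glue (k • ·) R p.1 p.2 x).symm)))

/-- The translation `v ↦ v (R + ·)` of `L²` functions. -/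
def translateL2 (hR : 0 ≤ R) : HalfLineL2 →ₗ[ℂ] HalfLineL2 where
  toFun v := (memLp_translate hR (Lp.memLp v)).toLp _
  map_add' u v := by
    rw [← MemLp.toLp_add]
    exact MemLp.toLp_congr _ _ (ae_translate hR (Lp.coeFn_add u v))
  map_smul' k v := by
    rw [RingHom.id_apply, ← MemLp.toLp_const_smul]
    exact MemLp.toLp_congr _ _ (ae_translate hR (Lp.coeFn_smul k v))

theorem coeFn_glueL2 (hR : 0 ≤ R) (u v : HalfLineL2) :
    glueL2 hR (u, v) =ᵐ[halfLineMeasure] glue R u v :=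
  (memLp_glue hR (Lp.memLp u) (Lp.memLp v)).coeFn_toLp

theorem coeFn_translateL2 (hR : 0 ≤ R) (v : HalfLineL2) :
    translateL2 hR v =ᵐ[halfLineMeasure] fun x => v (R + x) :=
  (memLp_translate hR (Lp.memLp v)).coeFn_toLp

theorem coeFn_glueL2_neg_right (hR : 0 ≤ R) (u v : HalfLineL2) :
    glueL2 hR (u, -v) =ᵐ[halfLineMeasure] glue R u (-v) :=
  (coeFn_glueL2 hR u (-v)).trans (glue_congr_ae hR .rfl (Lp.coeFn_neg v))

theorem intervalIntegral_congr_halfLine {f g : ℝ → ℂ} (h : f =ᵐ[halfLineMeasure] g) {a b : ℝ}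
    (ha : 0 ≤ a) (hab : a ≤ b) : ∫ t in a..b, f t = ∫ t in a..b, g t := by
  refine intervalIntegral.integral_congr_ae ?_
  filter_upwards [(ae_restrict_iff' measurableSet_Ioi).1 h] with t ht hmem
  rw [uIoc_of_le hab] at hmem
  exact ht (lt_of_le_of_lt ha hmem.1)

theorem primitive_glueL2_of_le (hR : 0 ≤ R) (c : ℂ) (u' v' : HalfLineL2) {x : ℝ} (hx : 0 ≤ x)
    (hxR : x ≤ R) :
    primitive (primitive c v' R) (glueL2 hR (u', -v')) x = primitive c v' (R - x) := by
  have hInt : ∫ t in (0 : ℝ)..x, glueL2 hR (u', -v') t = ∫ t in (0 : ℝ)..x, -v' (R - t) := by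
    rw [intervalIntegral_congr_halfLine (coeFn_glueL2_neg_right hR u' v') le_rfl hx]
    refine intervalIntegral.integral_congr fun t ht => ?_
    rw [uIcc_of_le hx] at ht
    exact glue_of_le _ _ (ht.2.trans hxR)
  rw [primitive, hInt, intervalIntegral.integral_neg, intervalIntegral.integral_comp_sub_left,
    sub_zero, ← primitive_sub_primitive c v' (sub_nonneg.2 hxR) hR]
  ring

theorem primitive_glueL2_of_ge (hR : 0 ≤ R) (c : ℂ) (u' v' : HalfLineL2) {x : ℝ} (hxR : R ≤ x) :
    primitive (primitive c v' R) (glueL2 hR (u', -v')) x = primitive c u' (x - R) := by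
  have hvertex := primitive_glueL2_of_le hR c u' v' hR le_rfl
  have hInt : ∫ t in R..x, glueL2 hR (u', -v') t = ∫ t in R..x, u' (t - R) := by
    rw [intervalIntegral_congr_halfLine (coeFn_glueL2_neg_right hR u' v') hR hxR]
    refine intervalIntegral.integral_congr_ae (.of_forall fun t ht => ?_)
    rw [uIoc_of_le hxR] at ht
    exact glue_of_lt _ _ ht.1
  have hdiff := primitive_sub_primitive (primitive c v' R) (glueL2 hR (u', -v')) hR (hR.trans hxR)
  rw [hvertex, hInt, intervalIntegral.integral_comp_sub_right, sub_self,
    primitive_zero_right] at hdiff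
  exact sub_eq_iff_eq_add'.1 hdiff

theorem HasDerivTrace.glueL2 (hR : 0 ≤ R) {u u' v v' : HalfLineL2} {c : ℂ}
    (hu : HasDerivTrace u u' c) (hv : HasDerivTrace v v' c) :
    HasDerivTrace (glueL2 hR (u, v)) (glueL2 hR (u', -v')) (primitive c v' R) := by
  filter_upwards [coeFn_glueL2 hR u v, ae_glue hR hu hv, ae_restrict_mem measurableSet_Ioi]
    with x hcoe htrace hx
  rw [hcoe]
  rcases le_or_gt x R with h | h
  · rw [glue_of_le _ _ h] at htrace ⊢
    exact htrace.trans (primitive_glueL2_of_le hR c u' v' (le_of_lt hx) h).symm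
  · rw [glue_of_lt _ _ h] at htrace ⊢
    exact htrace.trans (primitive_glueL2_of_ge hR c u' v' h.le).symm

theorem HasDerivTrace.translateL2 (hR : 0 ≤ R) {v v' : HalfLineL2} {c : ℂ}
    (hv : HasDerivTrace v v' c) :
    HasDerivTrace (translateL2 hR v) (translateL2 hR v') (primitive c v' R) := by
  filter_upwards [coeFn_translateL2 hR v, ae_translate hR hv, ae_restrict_mem measurableSet_Ioi]
    with x hcoe htrace hx
  have hx0 : 0 ≤ x := le_of_lt hx
  rw [hcoe, htrace, intervalIntegral_congr_halfLine (coeFn_translateL2 hR v') le_rfl hx0,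
    intervalIntegral.integral_comp_add_left, add_zero,
    ← primitive_sub_primitive c v' hR (add_nonneg hR hx0)]
  exact (add_sub_cancel _ _).symm

/-- The potential on a star graph that coincides, on the edge `k₀`, with the potential `V` on the
line up to the point `R` of its second edge, and on every other edge with the remaining part of
`V`. -/
def graftPotential {κ : Type} [DecidableEq κ] (k₀ : κ) (R : ℝ) (V : Fin 2 → ℝ → ℝ) (i : κ) :
    ℝ → ℝ :=
  if i = k₀ then glue R (V 0) (V 1) else fun x => V 1 (R + x)

variable {κ : Type} [DecidableEq κ] (k₀ : κ)

theorem graftPotential_self (R : ℝ) (V : Fin 2 → ℝ → ℝ) :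
    graftPotential k₀ R V k₀ = glue R (V 0) (V 1) := if_pos rfl

theorem graftPotential_of_ne {i : κ} (hi : i ≠ k₀) (R : ℝ) (V : Fin 2 → ℝ → ℝ) :
    graftPotential k₀ R V i = fun x => V 1 (R + x) := if_neg hi

theorem IsPotential.intervalIntegrable_posPart {ι : Type} {V : ι → ℝ → ℝ} (hV : IsPotential V)
    (i : ι) {S : ℝ} (hS : 0 ≤ S) : IntervalIntegrable (fun x => (V i x)⁺) volume 0 S :=
  (intervalIntegrable_iff_integrableOn_Ioc_of_le hS).2 (hV.posPart_loc i S)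

theorem IsPotential.graft (hR : 0 ≤ R) {V : Fin 2 → ℝ → ℝ} (hV : IsPotential V) :
    IsPotential (graftPotential k₀ R V) where
  posPart_loc i S := by
    rcases eq_or_ne i k₀ with rfl | hi
    · rw [graftPotential_self]
      have hglue := intervalIntegrable_glue hR (abs_nonneg S)
        (hV.intervalIntegrable_posPart 0 (abs_nonneg S)) (hV.intervalIntegrable_posPart 1 hR)
      rw [intervalIntegrable_iff_integrableOn_Ioc_of_le (add_nonneg hR (abs_nonneg S))] at hglue
      refine IntegrableOn.mono_set ?_
        (Ioc_subset_Ioc_right ((le_abs_self S).trans (le_add_of_nonneg_left hR)))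
      simpa only [map_glue fun y : ℝ => y⁺] using hglue
    · rw [graftPotential_of_ne k₀ hi]
      have htranslate := ((measurePreserving_add_left volume R).integrableOn_comp_preimage
        (measurableEmbedding_addLeft R)).2
        ((hV.posPart_loc 1 (R + S)).mono_set (Ioc_subset_Ioc_left hR))
      rwa [preimage_const_add_Ioc, sub_self, add_sub_cancel_left] at htranslate
  negPart_memLp := by
    obtain ⟨p, hp1, hp, hLp⟩ := hV.negPart_memLp
    refine ⟨p, hp1, hp, fun i => ?_⟩
    rcases eq_or_ne i k₀ with rfl | hi
    · rw [graftPotential_self]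
      simpa only [map_glue fun y : ℝ => y⁻] using memLp_glue hR (hLp 0) (hLp 1)
    · rw [graftPotential_of_ne k₀ hi]
      exact memLp_translate hR (hLp 1)

/-- The function on the edge `i` of a star graph obtained from a function on the line, given as
the pair of its restrictions: its part up to the point `R` of the second edge is moved to the edge
`k₀`, and the remaining part is copied to each of the other edges. -/
def graftL2 (hR : 0 ≤ R) (i : κ) : HalfLineL2 × HalfLineL2 →ₗ[ℂ] HalfLineL2 :=
  if i = k₀ then glueL2 hR else translateL2 hR ∘ₗ .snd ℂ _ _

/-- The effect of `graftL2` on derivatives; the sign accounts for the reversed orientation of the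
initial part of the second edge. -/
def graftDerivL2 (hR : 0 ≤ R) (i : κ) : HalfLineL2 × HalfLineL2 →ₗ[ℂ] HalfLineL2 :=
  if i = k₀ then glueL2 hR ∘ₗ LinearMap.id.prodMap (-LinearMap.id) else
    translateL2 hR ∘ₗ .snd ℂ _ _

theorem graftL2_self (hR : 0 ≤ R) (u v : HalfLineL2) :
    graftL2 k₀ hR k₀ (u, v) = glueL2 hR (u, v) := by
  rw [graftL2, if_pos rfl]

theorem graftL2_of_ne {i : κ} (hi : i ≠ k₀) (hR : 0 ≤ R) (u v : HalfLineL2) :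
    graftL2 k₀ hR i (u, v) = translateL2 hR v := by
  rw [graftL2, if_neg hi, LinearMap.comp_apply, LinearMap.snd_apply]

theorem graftDerivL2_self (hR : 0 ≤ R) (u' v' : HalfLineL2) :
    graftDerivL2 k₀ hR k₀ (u', v') = glueL2 hR (u', -v') := by
  rw [graftDerivL2, if_pos rfl]
  rfl

theorem graftDerivL2_of_ne {i : κ} (hi : i ≠ k₀) (hR : 0 ≤ R) (u' v' : HalfLineL2) :
    graftDerivL2 k₀ hR i (u', v') = translateL2 hR v' := by
  rw [graftDerivL2, if_neg hi, LinearMap.comp_apply, LinearMap.snd_apply]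

theorem hasDerivTrace_graftL2 (hR : 0 ≤ R) {u u' v v' : HalfLineL2} {c : ℂ}
    (hu : HasDerivTrace u u' c) (hv : HasDerivTrace v v' c) (i : κ) :
    HasDerivTrace (graftL2 k₀ hR i (u, v)) (graftDerivL2 k₀ hR i (u', v'))
      (primitive c v' R) := by
  rcases eq_or_ne i k₀ with rfl | hi
  · rw [graftL2_self, graftDerivL2_self]
    exact hu.glueL2 hR hv
  · rw [graftL2_of_ne k₀ hi, graftDerivL2_of_ne k₀ hi]
    exact hv.translateL2 hR

theorem graftL2_mem_weightedL2 (hR : 0 ≤ R) {V : Fin 2 → ℝ → ℝ} (hV : IsPotential V)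
    {u v : HalfLineL2} (hu : u ∈ weightedL2 (hV.aestronglyMeasurable 0))
    (hv : v ∈ weightedL2 (hV.aestronglyMeasurable 1)) (i : κ) :
    graftL2 k₀ hR i (u, v) ∈ weightedL2 ((hV.graft k₀ hR).aestronglyMeasurable i) := by
  rw [mem_weightedL2] at hu hv ⊢
  rcases eq_or_ne i k₀ with rfl | hi
  · rw [graftL2_self, graftPotential_self]
    refine (integrable_glue hR hu hv).congr ?_
    filter_upwards [coeFn_glueL2 hR u v] with x hx
    rw [hx]
    rcases le_or_gt x R with h | h
    · simp only [glue_of_le _ _ h]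
    · simp only [glue_of_lt _ _ h]
  · rw [graftL2_of_ne k₀ hi, graftPotential_of_ne k₀ hi]
    refine (integrable_translate hR hv).congr ?_
    filter_upwards [coeFn_translateL2 hR v] with x hx
    rw [hx]

variable [Fintype κ]

/-- `graftL2` and `graftDerivL2` as a map of form domains. -/
def graft (hR : 0 ≤ R) {V : Fin 2 → ℝ → ℝ} (hV : IsPotential V) :
    domain hV →ₗ[ℂ] domain (hV.graft k₀ hR) where
  toFun p := ⟨(WithLp.toLp 2 fun i => graftL2 k₀ hR i (p.1.1 0, p.1.1 1),
    WithLp.toLp 2 fun i => graftDerivL2 k₀ hR i (p.1.2 0, p.1.2 1)), by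
    obtain ⟨⟨c, hc⟩, hp⟩ := p.2
    exact ⟨⟨primitive c (p.1.2 1) R, hasDerivTrace_graftL2 k₀ hR (hc 0) (hc 1)⟩,
      graftL2_mem_weightedL2 k₀ hR hV (hp 0) (hp 1)⟩⟩
  map_add' _ _ := Subtype.ext (Prod.ext (PiLp.ext fun i => (graftL2 k₀ hR i).map_add (_, _) (_, _))
    (PiLp.ext fun i => (graftDerivL2 k₀ hR i).map_add (_, _) (_, _)))
  map_smul' k _ := Subtype.ext (Prod.ext (PiLp.ext fun i => (graftL2 k₀ hR i).map_smul k (_, _))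
    (PiLp.ext fun i => (graftDerivL2 k₀ hR i).map_smul k (_, _)))

theorem graft_fst_apply (hR : 0 ≤ R) {V : Fin 2 → ℝ → ℝ} {hV : IsPotential V} (p : domain hV)
    (i : κ) : (graft k₀ hR hV p).1.1 i = graftL2 k₀ hR i (p.1.1 0, p.1.1 1) := rfl

theorem graft_snd_apply (hR : 0 ≤ R) {V : Fin 2 → ℝ → ℝ} {hV : IsPotential V} (p : domain hV)
    (i : κ) : (graft k₀ hR hV p).1.2 i = graftDerivL2 k₀ hR i (p.1.2 0, p.1.2 1) := rfl

theorem edgeDensity_glueL2_ae_eq (hR : 0 ≤ R) (w₀ w₁ : ℝ → ℝ) (E : ℝ) (u u' v v' : HalfLineL2) :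
    edgeDensity (glue R w₀ w₁) E (glueL2 hR (u, v)) (glueL2 hR (u', -v')) =ᵐ[halfLineMeasure]
      glue R (edgeDensity w₀ E u u') (edgeDensity w₁ E v v') := by
  filter_upwards [coeFn_glueL2 hR u v, coeFn_glueL2_neg_right hR u' v'] with x hx hx'
  rw [edgeDensity, hx, hx']
  rcases le_or_gt x R with h | h
  · simp only [glue_of_le _ _ h, Pi.neg_apply, norm_neg, edgeDensity]
  · simp only [glue_of_lt _ _ h, edgeDensity]

theorem edgeDensity_translateL2_ae_eq (hR : 0 ≤ R) (w : ℝ → ℝ) (E : ℝ) (v v' : HalfLineL2) :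
    edgeDensity (fun x => w (R + x)) E (translateL2 hR v) (translateL2 hR v') =ᵐ[halfLineMeasure]
      fun x => edgeDensity w E v v' (R + x) := by
  filter_upwards [coeFn_translateL2 hR v, coeFn_translateL2 hR v'] with x hx hx'
  rw [edgeDensity, hx, hx', edgeDensity]

theorem energy_shift_graft (hR : 0 ≤ R) {V : Fin 2 → ℝ → ℝ} (hV : IsPotential V) (E : ℝ)
    (p : domain hV) :
    energy (shift (sesqForm (hV.graft k₀ hR)) (embed _) E) (graft k₀ hR hV p) =
      energy (shift (sesqForm hV) (embed hV) E) p + (Fintype.card κ - 2) *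
        ∫ x in Ioi R, edgeDensity (V 1) E (p.1.1 1) (p.1.2 1) x ∂halfLineMeasure := by
  have hInt := fun j => integrable_edgeDensity
    (integrable_mul_norm_sq_of_mem_weightedL2 (p.2.2 j)) E (p.1.2 j)
  have hself : ∫ x, edgeDensity (graftPotential k₀ R V k₀) E ((graft k₀ hR hV p).1.1 k₀)
      ((graft k₀ hR hV p).1.2 k₀) x ∂halfLineMeasure =
      ∫ x, glue R (edgeDensity (V 0) E (p.1.1 0) (p.1.2 0))
        (edgeDensity (V 1) E (p.1.1 1) (p.1.2 1)) x ∂halfLineMeasure := by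
    rw [graft_fst_apply, graft_snd_apply, graftL2_self, graftDerivL2_self, graftPotential_self]
    exact integral_congr_ae (edgeDensity_glueL2_ae_eq hR _ _ E _ _ _ _)
  have hother : ∀ i ∈ Finset.univ.erase k₀, ∫ x, edgeDensity (graftPotential k₀ R V i) E
      ((graft k₀ hR hV p).1.1 i) ((graft k₀ hR hV p).1.2 i) x ∂halfLineMeasure =
      ∫ x in Ioi R, edgeDensity (V 1) E (p.1.1 1) (p.1.2 1) x ∂halfLineMeasure := by
    intro i hi
    have hne := Finset.ne_of_mem_erase hi
    rw [graft_fst_apply, graft_snd_apply, graftL2_of_ne k₀ hne, graftDerivL2_of_ne k₀ hne,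
      graftPotential_of_ne k₀ hne]
    exact (integral_congr_ae (edgeDensity_translateL2_ae_eq hR _ E _ _)).trans
      (integral_translate hR _)
  rw [energy_shift_sesqForm, energy_shift_sesqForm, Fin.sum_univ_two,
    ← integral_glue_add_integral_Ioi hR (hInt 0) (hInt 1),
    ← Finset.add_sum_erase _ _ (Finset.mem_univ k₀), hself, Finset.sum_congr rfl hother,
    Finset.sum_const, Finset.card_erase_of_mem (Finset.mem_univ k₀), Finset.card_univ,
    nsmul_eq_mul, Nat.cast_pred (Fintype.card_pos_iff.2 ⟨k₀⟩)]
  ring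

end Grafting

section Perturbation

/-! ### Perturbation of negative definite forms -/

variable {D : Type*} [AddCommGroup D] [Module ℂ D]

variable {α : Type*} {l : Filter α} {B : α → D →ₗ⋆[ℂ] D →ₗ[ℂ] ℂ} {B₀ : D →ₗ⋆[ℂ] D →ₗ[ℂ] ℂ}

theorem tendsto_apply_of_tendsto_energy (hB : ∀ n, (B n).IsSymm) (hB₀ : B₀.IsSymm)
    (hlim : ∀ p, Tendsto (fun n => energy (B n) p) l (𝓝 (energy B₀ p))) (p q : D) :
    Tendsto (fun n => B n p q) l (𝓝 (B₀ p q)) := by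
  have hre : ∀ x y, Tendsto (fun n => (B n x y).re) l (𝓝 (B₀ x y).re) := by
    intro x y
    have hpolar : ∀ {A : D →ₗ⋆[ℂ] D →ₗ[ℂ] ℂ}, A.IsSymm →
        (energy A (x + y) - energy A x - energy A y) / 2 = (A x y).re := by
      intro A hA
      rw [energy_add hA]
      ring
    rw [← hpolar hB₀]
    exact ((((hlim (x + y)).sub (hlim x)).sub (hlim y)).div_const 2).congr fun n => hpolar (hB n)
  have him := hre (Complex.I • p) q
  simp only [← im_apply_eq_re] at him
  exact Complex.equivRealProdCLM.toHomeomorph.isInducing.tendsto_nhds_iff.2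
    ((hre p q).prodMk_nhds him)

-- By homogeneity it suffices to consider the unit sphere, which is compact.
theorem eventually_energy_sum_smul_neg (hB : ∀ n, (B n).IsSymm) (hB₀ : B₀.IsSymm)
    (hlim : ∀ p, Tendsto (fun n => energy (B n) p) l (𝓝 (energy B₀ p)))
    {κ : Type*} [Fintype κ] {f : κ → D}
    (hf : ∀ a : κ → ℂ, a ≠ 0 → energy B₀ (∑ i, a i • f i) < 0) :
    ∀ᶠ n in l, ∀ a : κ → ℂ, a ≠ 0 → energy (B n) (∑ i, a i • f i) < 0 := by
  let value (A : κ → κ → ℂ) (a : κ → ℂ) : ℝ := (∑ i, ∑ j, conj (a i) * a j * A i j).re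
  have hvalue : Continuous fun z : (κ → κ → ℂ) × (κ → ℂ) => value z.1 z.2 := by fun_prop
  have hcoeff : Tendsto (fun n i j => B n (f i) (f j)) l (𝓝 fun i j => B₀ (f i) (f j)) :=
    tendsto_pi_nhds.2 fun i => tendsto_pi_nhds.2 fun j =>
      tendsto_apply_of_tendsto_energy hB hB₀ hlim (f i) (f j)
  have hsphere : ∀ᶠ A in 𝓝 fun i j => B₀ (f i) (f j),
      ∀ a ∈ Metric.sphere (0 : κ → ℂ) 1, value A a < 0 := by
    refine (isCompact_sphere _ _).eventually_forall_of_forall_eventually fun a ha => ?_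
    refine hvalue.continuousAt.eventually_lt_const ?_
    exact (energy_sum_smul B₀ f a).symm.trans_lt (hf a (ne_zero_of_mem_unit_sphere ⟨a, ha⟩))
  filter_upwards [hcoeff.eventually hsphere] with n hn a ha
  have hneg := hn ((‖a‖⁻¹ : ℂ) • a) (mem_sphere_zero_iff_norm.2 (norm_smul_inv_norm ha))
  simp only [value, ← energy_sum_smul, Pi.smul_apply, smul_assoc, ← Finset.smul_sum,
    energy_smul] at hneg
  exact neg_of_mul_neg_right hneg (sq_nonneg _)

end Perturbation

section TransplantationLimit

/-! ### The line as a limit of star graphs -/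

theorem iInter_Ioi_natCast : ⋂ n : ℕ, Ioi (n : ℝ) = ∅ :=
  eq_empty_of_forall_notMem fun x hx =>
    (exists_nat_ge x).elim fun n hn => (mem_iInter.1 hx n).not_ge hn

theorem tendsto_integral_Ioi_natCast {μ : Measure ℝ} {f : ℝ → ℝ} (hf : Integrable f μ) :
    Tendsto (fun n : ℕ => ∫ x in Ioi (n : ℝ), f x ∂μ) atTop (𝓝 0) := by
  have h := tendsto_setIntegral_of_antitone (fun n : ℕ => measurableSet_Ioi)
    (fun m n hmn => Ioi_subset_Ioi (Nat.cast_le.2 hmn)) ⟨0, hf.integrableOn⟩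
  rwa [iInter_Ioi_natCast, setIntegral_empty] at h

theorem tendsto_lintegral_Ioi_natCast {μ : Measure ℝ} {f : ℝ → ℝ≥0∞} (hf : ∫⁻ x, f x ∂μ ≠ ∞) :
    Tendsto (fun n : ℕ => ∫⁻ x in Ioi (n : ℝ), f x ∂μ) atTop (𝓝 0) := by
  have h := tendsto_measure_iInter_atTop (μ := μ.withDensity f)
    (s := fun n : ℕ => Ioi (n : ℝ)) (fun _ => measurableSet_Ioi.nullMeasurableSet)
    (fun m n hmn => Ioi_subset_Ioi (Nat.cast_le.2 hmn)) ⟨0, by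
      rw [withDensity_apply _ measurableSet_Ioi]
      exact ne_top_of_le_ne_top hf (setLIntegral_le_lintegral _ _)⟩
  rw [iInter_Ioi_natCast, measure_empty] at h
  exact h.congr fun n => withDensity_apply _ measurableSet_Ioi

theorem toENNReal_le_of_forall_natCast_le {c : ℕ∞} {x : ℝ≥0∞}
    (h : ∀ k : ℕ, (k : ℕ∞) ≤ c → (k : ℝ≥0∞) ≤ x) : (c : ℝ≥0∞) ≤ x := by
  induction c using ENat.recTopCoe with
  | top =>
    rw [ENat.toENNReal_top, ← ENNReal.iSup_natCast]
    exact iSup_le fun k => h k le_top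
  | coe k => exact h k le_rfl

variable {κ : Type} [Fintype κ] [DecidableEq κ] (k₀ : κ)

theorem tendsto_energy_shift_graft {V : Fin 2 → ℝ → ℝ} (hV : IsPotential V) (E : ℝ)
    (p : domain hV) :
    Tendsto (fun n : ℕ => energy (shift (sesqForm (hV.graft k₀ n.cast_nonneg)) (embed _) E)
      (graft k₀ n.cast_nonneg hV p)) atTop (𝓝 (energy (shift (sesqForm hV) (embed hV) E) p)) := by
  simp only [energy_shift_graft]
  have htail := tendsto_integral_Ioi_natCast (integrable_edgeDensity
    (integrable_mul_norm_sq_of_mem_weightedL2 (p.2.2 1)) E (p.1.2 1))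
  simpa only [mul_zero, add_zero] using (htail.const_mul _).const_add _

theorem count_le_liminf_count_graft {V : Fin 2 → ℝ → ℝ} (hV : IsPotential V) {E : ℝ}
    (hE : E ≤ 0) : (count hV E : ℝ≥0∞) ≤
      liminf (fun n : ℕ => (count (hV.graft k₀ n.cast_nonneg) E : ℝ≥0∞)) atTop := by
  refine toENNReal_le_of_forall_natCast_le fun k hk => le_liminf_of_le (by isBoundedDefault) ?_
  obtain ⟨f, hf⟩ := (hasDiscreteSpectrumBelow hV hE).natCast_le_formCount_iff.1 hk
  let B (n : ℕ) : domain hV →ₗ⋆[ℂ] domain hV →ₗ[ℂ] ℂ :=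
    ((shift (sesqForm (hV.graft k₀ n.cast_nonneg)) (embed _) E).compl₂
      (graft k₀ n.cast_nonneg hV)).comp (graft k₀ n.cast_nonneg hV)
  have hB : ∀ n, (B n).IsSymm := fun n =>
    ⟨fun p q => (shift_isSymm (sesqForm_isSymm _) _ E).eq _ _⟩
  filter_upwards [eventually_energy_sum_smul_neg hB (shift_isSymm (sesqForm_isSymm hV) _ E)
    (tendsto_energy_shift_graft k₀ hV E) hf] with n hn
  rw [← ENat.toENNReal_coe, ENat.toENNReal_le]
  refine (hasDiscreteSpectrumBelow (hV.graft k₀ n.cast_nonneg) hE).natCast_le_formCount_iff.2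
    ⟨fun i => graft k₀ n.cast_nonneg hV (f i), fun a ha => ?_⟩
  simp only [← map_smul, ← map_sum]
  exact hn a ha

theorem traceNeg_le_liminf_traceNeg_graft {V : Fin 2 → ℝ → ℝ} (hV : IsPotential V) {γ : ℝ}
    (hγ : 0 < γ) :
    traceNeg γ V ≤ liminf (fun n : ℕ => traceNeg γ (graftPotential k₀ n V)) atTop := by
  simp only [traceNeg_eq_lintegral_count hV hγ,
    fun n : ℕ => traceNeg_eq_lintegral_count (hV.graft k₀ n.cast_nonneg) hγ]
  refine (setLIntegral_mono' measurableSet_Ioi fun s hs => ?_).trans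
    (lintegral_liminf_le fun n => measurable_count_neg_rpow (hV.graft k₀ n.cast_nonneg) γ)
  exact count_le_liminf_count_graft k₀ hV (neg_nonpos.2 (Real.rpow_nonneg (le_of_lt hs) _))

theorem negIntegral_graft_le {R : ℝ} (hR : 0 ≤ R) (V : Fin 2 → ℝ → ℝ) (γ : ℝ) :
    negIntegral γ (graftPotential k₀ R V) ≤ negIntegral γ V + Fintype.card κ *
      ∫⁻ x in Ioi R, ENNReal.ofReal ((V 1 x)⁻ ^ (γ + 1 / 2)) ∂halfLineMeasure := by
  have hself : ∫⁻ x in Ioi (0 : ℝ),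
      ENNReal.ofReal ((graftPotential k₀ R V k₀ x)⁻ ^ (γ + 1 / 2)) ≤ negIntegral γ V := by
    simp only [graftPotential_self, map_glue fun y : ℝ => ENNReal.ofReal (y⁻ ^ (γ + 1 / 2))]
    rw [negIntegral, Fin.sum_univ_two]
    exact lintegral_glue_le hR _ _
  have hother : ∀ i ∈ Finset.univ.erase k₀,
      ∫⁻ x in Ioi (0 : ℝ), ENNReal.ofReal ((graftPotential k₀ R V i x)⁻ ^ (γ + 1 / 2)) =
      ∫⁻ x in Ioi R, ENNReal.ofReal ((V 1 x)⁻ ^ (γ + 1 / 2)) ∂halfLineMeasure := by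
    intro i hi
    rw [graftPotential_of_ne k₀ (Finset.ne_of_mem_erase hi)]
    exact lintegral_translate hR fun x => ENNReal.ofReal ((V 1 x)⁻ ^ (γ + 1 / 2))
  rw [negIntegral, ← Finset.add_sum_erase _ _ (Finset.mem_univ k₀), Finset.sum_congr rfl hother,
    Finset.sum_const, nsmul_eq_mul]
  gcongr
  exact Finset.card_le_univ _

end TransplantationLimit

section Comparison

/-! ### Comparison of the optimal constants -/

theorem lineConst_le_optConst {γ : ℝ} (hγ : 0 < γ) {N : ℕ} (hN : N ≠ 0) :
    lineConst γ ≤ optConst γ N := by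
  refine sInf_le fun V hV hI => ?_
  have : NeZero N := ⟨hN⟩
  set bound : ℕ → ℝ≥0∞ := fun n => negIntegral γ V + N *
    ∫⁻ x in Ioi (n : ℝ), ENNReal.ofReal ((V 1 x)⁻ ^ (γ + 1 / 2)) ∂halfLineMeasure
  have hle : ∀ n : ℕ, negIntegral γ (graftPotential (0 : Fin N) n V) ≤ bound n := fun n => by
    simpa only [Fintype.card_fin] using negIntegral_graft_le (0 : Fin N) n.cast_nonneg V γ
  have hfin : ∫⁻ x, ENNReal.ofReal ((V 1 x)⁻ ^ (γ + 1 / 2)) ∂halfLineMeasure ≠ ∞ :=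
    ENNReal.sum_ne_top.1 hI 1 (Finset.mem_univ _)
  have hboundfin : ∀ n, bound n ≠ ∞ := fun n =>
    ENNReal.add_ne_top.2 ⟨hI, ENNReal.mul_ne_top (ENNReal.natCast_ne_top N)
      (ne_top_of_le_ne_top hfin (setLIntegral_le_lintegral _ _))⟩
  have hlim : Tendsto bound atTop (𝓝 (negIntegral γ V)) := by
    have htail := ENNReal.Tendsto.const_mul (a := (N : ℝ≥0∞)) (tendsto_lintegral_Ioi_natCast hfin)
      (.inr (ENNReal.natCast_ne_top N))
    simpa only [mul_zero, add_zero] using htail.const_add (negIntegral γ V)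
  rcases eq_or_ne (negIntegral γ V) 0 with h0 | h0
  · exact (traceNeg_eq_zero hV hγ h0).trans_le zero_le
  calc traceNeg γ V
      ≤ liminf (fun n : ℕ => traceNeg γ (graftPotential (0 : Fin N) n V)) atTop :=
        traceNeg_le_liminf_traceNeg_graft 0 hV hγ
    _ ≤ liminf (fun n => optConst γ N * bound n) atTop :=
        liminf_le_liminf (.of_forall fun n => (traceNeg_le_optConst_mul hγ
          (hV.graft 0 n.cast_nonneg) (ne_top_of_le_ne_top (hboundfin n) (hle n))).trans
            (mul_le_mul_right (hle n) _))
    _ = optConst γ N * negIntegral γ V := (ENNReal.Tendsto.const_mul hlim (.inl h0)).liminf_eq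

theorem optConst_le_of_odd {γ : ℝ} (hγ : 0 < γ) {N₀ N : ℕ} (h₀ : Odd N₀) (h : Odd N)
    (hle : N₀ ≤ N) :
    optConst γ N ≤ ENNReal.ofReal (((N : ℝ) - (N₀ : ℝ)) / (N : ℝ)) * lineConst γ +
      ENNReal.ofReal ((N₀ : ℝ) / (N : ℝ)) * optConst γ N₀ := by
  obtain ⟨m, hm⟩ := (Nat.Odd.sub_odd h h₀).two_dvd
  have hN : N = m * 2 + N₀ := by omega
  have hcast : (N : ℝ) - N₀ = (m * 2 : ℕ) := by
    rw [hN, Nat.cast_add, add_sub_cancel_right]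
  have hpos : (0 : ℝ) < N := Nat.cast_pos.2 h.pos
  have hadd := optConst_add_le hγ (m * 2) N₀
  rw [hcast, ENNReal.ofReal_div_of_pos hpos, ENNReal.ofReal_div_of_pos hpos,
    ENNReal.ofReal_natCast, ENNReal.ofReal_natCast, ENNReal.ofReal_natCast]
  rw [← hN] at hadd
  refine hadd.trans ?_
  gcongr
  exact optConst_mul_le hγ m 2

theorem optConst_eq_lineConst {γ : ℝ} (hγ : 0 < γ) {N₀ N : ℕ} (h₀ : Odd N₀)
    (h : optConst γ N₀ = lineConst γ) (hle : N₀ ≤ N) : optConst γ N = lineConst γ := by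
  refine le_antisymm ?_ (lineConst_le_optConst hγ (h₀.pos.trans_le hle).ne')
  rcases Nat.even_or_odd N with heven | hodd
  · obtain ⟨m, rfl⟩ := heven
    rw [← mul_two]
    exact optConst_mul_le hγ m 2
  · have hpos : (0 : ℝ) < N := Nat.cast_pos.2 hodd.pos
    have hle' : (N₀ : ℝ) ≤ N := Nat.cast_le.2 hle
    refine (optConst_le_of_odd hγ h₀ hodd hle).trans_eq ?_
    rw [h, ← add_mul, ← ENNReal.ofReal_add (div_nonneg (sub_nonneg.2 hle') hpos.le)
      (by positivity), ← add_div, sub_add_cancel, div_self hpos.ne', ENNReal.ofReal_one, one_mul]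

end Comparison

end StarGraph

end

theorem mainTheorem3_general (γ : ℝ) (hγ : 0 < γ) :
    (∀ N₀ N : ℕ, Odd N₀ → Odd N → N₀ < N →
      StarGraph.optConst γ N ≤
        ENNReal.ofReal (((N : ℝ) - (N₀ : ℝ)) / (N : ℝ)) * StarGraph.lineConst γ +
          ENNReal.ofReal ((N₀ : ℝ) / (N : ℝ)) * StarGraph.optConst γ N₀) ∧
    (∀ N₀ : ℕ, Odd N₀ → StarGraph.optConst γ N₀ = StarGraph.lineConst γ →
      ∀ N : ℕ, N₀ ≤ N → StarGraph.optConst γ N = StarGraph.lineConst γ) :=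
  ⟨fun _ _ h₀ h hlt => StarGraph.optConst_le_of_odd hγ h₀ h hlt.le,
    fun _ h₀ heq _ hle => StarGraph.optConst_eq_lineConst hγ h₀ heq hle⟩

theorem mainTheorem3 (γ : ℝ) (hγ : 1 / 2 ≤ γ) :
    (∀ N₀ N : ℕ, Odd N₀ → Odd N → N₀ < N →
      StarGraph.optConst γ N ≤
        ENNReal.ofReal (((N : ℝ) - (N₀ : ℝ)) / (N : ℝ)) * StarGraph.lineConst γ +
          ENNReal.ofReal ((N₀ : ℝ) / (N : ℝ)) * StarGraph.optConst γ N₀) ∧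
    (∀ N₀ : ℕ, Odd N₀ → StarGraph.optConst γ N₀ = StarGraph.lineConst γ →
      ∀ N : ℕ, N₀ ≤ N → StarGraph.optConst γ N = StarGraph.lineConst γ) :=
  mainTheorem3_general γ (by linarith)
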